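/- Let $\lambda,a$ be real with $a>0$, and assume either $-1<\lambda<0$, or $\lambda>0$ and $a>\tfrac12(1+\lambda)\lambda^{(1-\lambda)/(1+\lambda)}$. For real $\mu,z$ put $$W_{\lambda,\mu}(z)=\sum_{n\ge 0}\frac{z^n}{n!\,\Gamma(\lambda n+\mu)}$$ (with $1/\Gamma=0$ at the poles of $\Gamma$); this series converges for all real $\mu,z$. For $x>0$ put $\mathcal W^-_{\lambda,\nu}(x)=(x/2)^\nu\,W_{\lambda,\nu+1}\bigl(-(x/2)^{\lambda+1}\bigr)$. Let $h(u)=\tfrac12(e^u-e^{-\lambda u})-au$. The saddle point equation $h'(u)=0$, that is $e^u+\lambda e^{-\lambda u}=2a$, has exactly one real root if $\lambda<0$ and exactly two real roots if $\lambda>0$. Let $u_0$ be its only, respectively its larger, real root and write $h_0^{(n)}=h^{(n)}(u_0)$, $\mathbf h_n=h_0^{(n)}/h_0''$. Then $h_0''>0$ and $$h_0^{(n)}=\tfrac12\bigl(1-(-\lambda)^{n-1}\bigr)e^{u_0}+a(-\lambda)^{n-1}\qquad(n\ge 2).$$ There are a function $u=u(w)$, analytic at $w=0$, with $$-\tfrac12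 w^2=h(u)-h(u_0),\qquad u-u_0=\frac{w}{\sqrt{-h_0''}}+O(w^2)\qquad(w\to0),\qquad \frac1{\sqrt{-h_0''}}:=\frac{i}{\sqrt{h_0''}},$$ and real numbers $A_0,A_1,A_2,\dots$ such that the even part of its derivative is, for $w$ near $0$, $$\frac{u'(w)+u'(-w)}2=\frac1{\sqrt{-h_0''}}\sum_{k\ge0}(-1)^kA_kw^{2k}.$$ Moreover $A_0=1$, $$A_1=\frac{5\mathbf h_3^2-3\mathbf h_4}{24h_0''},\qquad A_2=\frac{385\mathbf h_3^4-630\mathbf h_3^2\mathbf h_4+105\mathbf h_4^2+168\mathbf h_3\mathbf h_5-24\mathbf h_6}{3456\,h_0''^2},$$ $$\begin{aligned}A_3=\frac{1}{6220800\,h_0''^3}\bigl(&425425\mathbf h_3^6-1126125\mathbf h_3^4\mathbf h_4+675675\mathbf h_3^2\mathbf h_4^2-51975\mathbf h_4^3+360360\mathbf h_3^3\mathbf h_5\\&-249480\mathbf h_3\mathbf h_4\mathbf h_5+13608\mathbf h_5^2-83160\mathbf h_3^2\mathbf h_6+22680\mathbf h_4\mathbf h_6+12960\mathbf h_3\mathbf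 h_7-1080\mathbf h_8\bigr),\end{aligned}$$ and, with $\nu=ax$ and $(\tfrac12)_k=\tfrac12(\tfrac12+1)\cdots(\tfrac12+k-1)$, $$\mathcal W^-_{\lambda,\nu}(x)\sim\frac{e^{xh(u_0)}}{\sqrt{2\pi xh_0''}}\sum_{k\ge0}\frac{(-1)^k(\frac12)_kA_k}{(x/2)^k}\qquad(x\to+\infty)$$ as a Poincaré asymptotic expansion: for every $N\ge0$, $$\mathcal W^-_{\lambda,ax}(x)=\frac{e^{xh(u_0)}}{\sqrt{2\pi xh_0''}}\left(\sum_{k=0}^{N-1}\frac{(-1)^k(\frac12)_kA_k}{(x/2)^k}+O(x^{-N})\right)\qquad(x\to+\infty).$$ -/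

import Mathlib

open Filter Topology Asymptotics

noncomputable section

/-- The Wright function `W_{λ,μ}(z) = ∑ zⁿ / (n! Γ(λ n + μ))` for real parameters and real argument.
At a pole of `Γ` Mathlib puts `Gamma = 0`, so such a term is `0`, as it is with the usual
convention that the reciprocal Gamma function is entire. -/
def wrightW (lam mu z : ℝ) : ℝ :=
  ∑' n : ℕ, z ^ n / ((n.factorial : ℝ) * Real.Gamma (lam * n + mu))

/-- `𝒲⁻_{λ,ν}(x) = (x/2)^ν W_{λ,ν+1}(-(x/2)^{λ+1})`, for `x > 0`. -/
def wrightMinus (lam nu x : ℝ) : ℝ :=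
  (x / 2) ^ nu * wrightW lam (nu + 1) (-((x / 2) ^ (lam + 1)))

/-- The phase function `h(u) = (e^u - e^{-λu})/2 - a u` on the real line. -/
def phase (lam a u : ℝ) : ℝ :=
  (Real.exp u - Real.exp (-lam * u)) / 2 - a * u

/-- The same phase function on the complex plane. -/
def phaseC (lam a : ℝ) (u : ℂ) : ℂ :=
  (Complex.exp u - Complex.exp (-(lam : ℂ) * u)) / 2 - (a : ℂ) * u

/-- The real solutions `u` of the saddle point equation `e^u + λ e^{-λu} = 2a`. -/
def realSaddles (lam a : ℝ) : Set ℝ :=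
  {u : ℝ | Real.exp u + lam * Real.exp (-lam * u) = 2 * a}

/-- The derivative `h₀^{(n)} = h^{(n)}(u₀)`. -/
def phaseDeriv (lam a u0 : ℝ) (n : ℕ) : ℝ :=
  iteratedDeriv n (phase lam a) u0

/-- The normalized derivative `h₀^{(n)} / h₀''`. -/
def phaseRatio (lam a u0 : ℝ) (n : ℕ) : ℝ :=
  phaseDeriv lam a u0 n / phaseDeriv lam a u0 2

/-- The value `1/√(-h₀'') = i/√(h₀'')`, for the branch `√(-h₀'') = -i √(h₀'')`. -/
def invSqrtNeg (lam a u0 : ℝ) : ℂ :=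
  Complex.I / ((Real.sqrt (phaseDeriv lam a u0 2) : ℝ) : ℂ)

/-- `u = u(w)` is the local inversion at the saddle point `u₀` of the quadratic normal form
`-w²/2 = h(u) - h(u₀)`: it is analytic at `w = 0` and `u - u₀ = w/√(-h₀'') + O(w²)`. -/
structure IsLocalReversion (lam a u0 : ℝ) (u : ℂ → ℂ) : Prop where
  analyticAt : AnalyticAt ℂ u 0
  map_zero : u 0 = (u0 : ℂ)
  deriv_zero : deriv u 0 = invSqrtNeg lam a u0
  normal_form : ∀ᶠ w in 𝓝 (0 : ℂ),
    -(w ^ 2) / 2 = phaseC lam a (u w) - phaseC lam a (u0 : ℂ)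

/-- `A` is the sequence of coefficients of the even part of `du/dw`, that is
`(u'(w) + u'(-w))/2 = 1/√(-h₀'') ∑ (-1)^k A_k w^{2k}` near `w = 0`. -/
def IsReversionCoeffs (lam a u0 : ℝ) (A : ℕ → ℝ) : Prop :=
  ∃ u : ℂ → ℂ, IsLocalReversion lam a u0 u ∧
    ∀ᶠ w in 𝓝 (0 : ℂ),
      HasSum (fun k : ℕ => invSqrtNeg lam a u0 * ((-1) ^ k * (A k : ℂ) * w ^ (2 * k)))
        ((deriv u w + deriv u (-w)) / 2)

/-- The factor `e^{x h(u₀)} / √(2π x h₀'')` in front of the expansion. -/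
def saddlePrefactor (lam a u0 x : ℝ) : ℝ :=
  Real.exp (x * phase lam a u0) / Real.sqrt (2 * Real.pi * x * phaseDeriv lam a u0 2)

/-- The Pochhammer symbol `(c)_k = c (c+1) ⋯ (c+k-1)`. -/
def poch (c : ℝ) (k : ℕ) : ℝ := (ascPochhammer ℝ k).eval c

end

/-!
Fourier inversion of the Gamma density gives Hankel's integral for `1/Γ`. Summed over `n`, it
represents the Wright function on a contour bent to the left, which for `z ≤ 0` may be straightened
to a vertical line because `exp (z t^{-λ})` is bounded in a sector wider than the right half plane.
With `t = (x/2) e^u` and `ν = a x` the integrand becomes `exp (x h(u))`, and the line is taken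
through `(x/2) e^{u₀}`.

Along this line `re h` decreases strictly away from the saddle point: for `λ > 0` this comes down to
`sin ((1 + λ) θ) ≤ (1 + λ) sin θ`, the saddle point equation and `h₀'' > 0`. So only a neighbourhood
of the saddle point matters. There `h(u) - h(u₀) = -w²/2` defines a coordinate `w`, a primitive of
the integrand moves the path to a real interval in `w`, and only the even part of `u'(w)` is left to
be integrated against the Gaussian weight. Its Taylor coefficients come from reverting the square
root of `h(u) - h(u₀)`.
-/

noncomputable section

open MeasureTheory Set
open Complex (I slitPlane)
open scoped Real ComplexConjugate FourierTransform

/-! ### The Bromwich integral of the reciprocal Gamma function -/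

theorem norm_cpow_mul_cexp_neg_mul {s r : ℂ} {t : ℝ} (ht : 0 < t) :
    ‖(t : ℂ) ^ (s - 1) * Complex.exp (-(r * t))‖ = t ^ (s.re - 1) * Real.exp (-(r.re * t)) := by
  rw [norm_mul, Complex.norm_exp, Complex.norm_cpow_eq_rpow_re_of_pos ht]
  simp

theorem integrableOn_rpow_mul_exp_neg_mul_Ioi {s c : ℝ} (hs : 0 < s) (hc : 0 < c) :
    IntegrableOn (fun t : ℝ => t ^ (s - 1) * Real.exp (-(c * t))) (Ioi 0) := by
  simpa [neg_mul] using
    integrableOn_rpow_mul_exp_neg_mul_rpow (s := s - 1) (by linarith) one_pos hc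

theorem aestronglyMeasurable_cpow_mul_cexp_neg_mul (s r : ℂ) :
    AEStronglyMeasurable (fun t : ℝ => (t : ℂ) ^ (s - 1) * Complex.exp (-(r * t)))
      (volume.restrict (Ioi 0)) := by
  refine ContinuousOn.aestronglyMeasurable (fun t ht => ?_) measurableSet_Ioi
  have : (t : ℂ) ∈ slitPlane := Complex.ofReal_mem_slitPlane.2 ht
  refine ContinuousAt.continuousWithinAt ?_
  fun_prop (disch := assumption)

theorem integrableOn_cpow_mul_cexp_neg_mul {s r : ℂ} (hs : 0 < s.re) (hr : 0 < r.re) :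
    IntegrableOn (fun t : ℝ => (t : ℂ) ^ (s - 1) * Complex.exp (-(r * t))) (Ioi 0) := by
  refine Integrable.mono' (integrableOn_rpow_mul_exp_neg_mul_Ioi hs hr)
    (aestronglyMeasurable_cpow_mul_cexp_neg_mul s r) ?_
  filter_upwards [ae_restrict_mem measurableSet_Ioi] with t ht
  exact (norm_cpow_mul_cexp_neg_mul ht).le

theorem differentiableOn_integral_cpow_mul_cexp_neg_mul {s : ℂ} (hs : 0 < s.re) :
    DifferentiableOn ℂ (fun r : ℂ => ∫ t : ℝ in Ioi 0, (t : ℂ) ^ (s - 1) * Complex.exp (-(r * t)))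
      {r | 0 < r.re} := by
  intro r hr
  have hr2 : 0 < r.re / 2 := half_pos hr
  refine ((hasDerivAt_integral_of_dominated_loc_of_deriv_le
    (s := {w : ℂ | r.re / 2 < w.re})
    (F := fun (w : ℂ) (t : ℝ) => (t : ℂ) ^ (s - 1) * Complex.exp (-(w * t)))
    (bound := fun t => t ^ (s.re + 1 - 1) * Real.exp (-(r.re / 2 * t)))
    (F' := fun (w : ℂ) (t : ℝ) => -((t : ℂ) ^ (s + 1 - 1) * Complex.exp (-(w * t))))
    ?_ ?_ (integrableOn_cpow_mul_cexp_neg_mul hs hr) ?_ ?_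
    (integrableOn_rpow_mul_exp_neg_mul_Ioi (by linarith) hr2)
    ?_).2).differentiableAt.differentiableWithinAt
  · exact (isOpen_lt continuous_const Complex.continuous_re).mem_nhds
      (half_lt_self (show 0 < r.re from hr))
  · exact Eventually.of_forall fun w => aestronglyMeasurable_cpow_mul_cexp_neg_mul s w
  · exact (aestronglyMeasurable_cpow_mul_cexp_neg_mul (s + 1) r).neg
  · filter_upwards [ae_restrict_mem measurableSet_Ioi] with t (ht : 0 < t) w (hw : _ < _)
    rw [norm_neg, norm_cpow_mul_cexp_neg_mul ht, Complex.add_re, Complex.one_re]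
    gcongr
  · filter_upwards [ae_restrict_mem measurableSet_Ioi] with t (ht : 0 < t) w _
    have hpow : (t : ℂ) ^ (s + 1 - 1) = (t : ℂ) ^ (s - 1) * t := by
      rw [add_sub_right_comm, Complex.cpow_add _ _ (by exact_mod_cast ht.ne'), Complex.cpow_one]
    refine ((((hasDerivAt_id w).mul_const (t : ℂ)).neg.cexp).const_mul
      ((t : ℂ) ^ (s - 1))).congr_deriv ?_
    rw [hpow]
    simp only [id, Pi.neg_apply]
    ring

/-- Both sides are holomorphic in `r`, so the known case of real `r` suffices. -/
theorem integral_cpow_mul_cexp_neg_mul {s r : ℂ} (hs : 0 < s.re) (hr : 0 < r.re) :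
    ∫ t : ℝ in Ioi 0, (t : ℂ) ^ (s - 1) * Complex.exp (-(r * t)) = r ^ (-s) * Complex.Gamma s := by
  have hopen : IsOpen {w : ℂ | 0 < w.re} := isOpen_lt continuous_const Complex.continuous_re
  have hrhs : DifferentiableOn ℂ (fun w : ℂ => w ^ (-s) * Complex.Gamma s) {w | 0 < w.re} := by
    intro w hw
    have : w ∈ slitPlane := Or.inl hw
    refine DifferentiableAt.differentiableWithinAt ?_
    fun_prop (disch := assumption)
  have hreal : ∀ c : ℝ, 0 < c → ∫ t : ℝ in Ioi 0, (t : ℂ) ^ (s - 1) * Complex.exp (-(c * t)) =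
      (c : ℂ) ^ (-s) * Complex.Gamma s := by
    intro c hc
    rw [Complex.integral_cpow_mul_exp_neg_mul_Ioi hs hc, one_div, Complex.inv_cpow,
      Complex.cpow_neg]
    rw [Complex.arg_ofReal_of_nonneg hc.le]
    exact Real.pi_pos.ne
  refine ((differentiableOn_integral_cpow_mul_cexp_neg_mul hs).analyticOnNhd
    hopen).eqOn_of_preconnected_of_frequently_eq (hrhs.analyticOnNhd hopen)
    (convex_halfSpace_re_gt 0).isPreconnected (z₀ := 1) (by simp) ?_ hr
  have hseq : Tendsto (fun c : ℝ => (c : ℂ)) (𝓝[>] 1) (𝓝[≠] 1) := by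
    refine tendsto_nhdsWithin_iff.2 ⟨?_, ?_⟩
    · exact (Complex.continuous_ofReal.tendsto' 1 1 Complex.ofReal_one).mono_left
        nhdsWithin_le_nhds
    · filter_upwards [self_mem_nhdsWithin] with c (hc : 1 < c)
      simpa using hc.ne'
  refine hseq.frequently (Eventually.frequently ?_)
  filter_upwards [self_mem_nhdsWithin] with c (hc : 1 < c)
  exact hreal c (one_pos.trans hc)

theorem rpow_neg_le_mul_one_add_sq_rpow {c y r s : ℝ} (hc : 0 < c) (hs : 0 ≤ s) (hcr : c ≤ r)
    (hy : |y| ≤ r) : r ^ (-s) ≤ (1 + (c ^ 2)⁻¹) ^ (s / 2) * (1 + y ^ 2) ^ (-s / 2) := by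
  have hr : 0 < r := hc.trans_le hcr
  have hsq : 1 + y ^ 2 ≤ (1 + (c ^ 2)⁻¹) * r ^ 2 := by
    have hy2 : y ^ 2 ≤ r ^ 2 := by rw [← sq_abs y]; gcongr
    have hc2 : 1 ≤ (c ^ 2)⁻¹ * r ^ 2 := by
      rw [le_inv_mul_iff₀ (by positivity), mul_one]
      gcongr
    linarith
  have hpow : (1 + y ^ 2) ^ (s / 2) ≤ (1 + (c ^ 2)⁻¹) ^ (s / 2) * r ^ s := by
    calc (1 + y ^ 2) ^ (s / 2) ≤ ((1 + (c ^ 2)⁻¹) * r ^ 2) ^ (s / 2) := by gcongr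
      _ = (1 + (c ^ 2)⁻¹) ^ (s / 2) * r ^ s := by
        rw [Real.mul_rpow (by positivity) (by positivity), ← Real.rpow_natCast r 2,
          ← Real.rpow_mul hr.le]
        congr 2
        push_cast
        ring
  rw [neg_div, Real.rpow_neg hr.le, Real.rpow_neg (by positivity), ← div_eq_mul_inv,
    le_div_iff₀ (by positivity), inv_mul_le_iff₀ (by positivity), mul_comm (r ^ s)]
  exact hpow

theorem integrable_one_add_sq_rpow {s : ℝ} (hs : 1 < s) :
    Integrable fun y : ℝ => (1 + y ^ 2) ^ (-s / 2) := by
  simpa using integrable_rpow_neg_one_add_norm_sq (E := ℝ) (μ := volume) (by simpa using hs)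

theorem le_norm_add_mul_I (c y : ℝ) : c ≤ ‖(c + y * I : ℂ)‖ := by
  simpa using Complex.re_le_norm (c + y * I)

theorem add_mul_I_mem_slitPlane {c : ℝ} (hc : 0 < c) (y : ℝ) : (c + y * I : ℂ) ∈ slitPlane :=
  Or.inl (by simpa using hc)

theorem integral_eq_two_mul_re_of_conj {F : ℝ → ℂ} (hF : Integrable F)
    (hconj : ∀ y, F (-y) = conj (F y)) :
    ∫ y, F y = ((2 * (∫ y in Ioi 0, F y).re : ℝ) : ℂ) := by
  rw [← intervalIntegral.integral_Iic_add_Ioi (b := 0) hF.integrableOn hF.integrableOn]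
  have hneg : ∫ y in Iic 0, F y = conj (∫ y in Ioi 0, F y) := by
    rw [← integral_conj, ← neg_zero, ← integral_comp_neg_Ioi]
    simp [hconj]
  rw [hneg, add_comm, Complex.add_conj]

/-- The point at height `y` on the ray that leaves `c` in the direction `I - d`. For `d > 0` these
rays form the upper halves of Hankel type contours; for `d = 0` the ray is vertical. -/
def rayPoint (c d y : ℝ) : ℂ := c + y * (I - d)

@[simp]
theorem rayPoint_re (c d y : ℝ) : (rayPoint c d y).re = c - d * y := by
  simp only [rayPoint, Complex.add_re, Complex.mul_re, Complex.sub_re, Complex.sub_im,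
    Complex.ofReal_re, Complex.ofReal_im, Complex.I_re, Complex.I_im]
  ring

@[simp]
theorem rayPoint_im (c d y : ℝ) : (rayPoint c d y).im = y := by
  simp [rayPoint]

theorem rayPoint_zero_right (c d : ℝ) : rayPoint c d 0 = c := by simp [rayPoint]

theorem rayPoint_zero_slope (c y : ℝ) : rayPoint c 0 y = c + y * I := by simp [rayPoint]

theorem rayPoint_mem_slitPlane {c : ℝ} (hc : 0 < c) (d y : ℝ) : rayPoint c d y ∈ slitPlane := by
  rw [Complex.mem_slitPlane_iff, rayPoint_re, rayPoint_im]
  rcases eq_or_ne y 0 with rfl | hy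
  · left; simpa using hc
  · exact Or.inr hy

theorem abs_le_norm_rayPoint (c d y : ℝ) : |y| ≤ ‖rayPoint c d y‖ := by
  simpa using Complex.abs_im_le_norm (rayPoint c d y)

theorem half_le_norm_rayPoint {c d y : ℝ} (hd : d ≤ 1) (hy : 0 ≤ y) :
    c / 2 ≤ ‖rayPoint c d y‖ := by
  rcases le_total (c / 2) y with hcy | hcy
  · exact (hcy.trans (le_abs_self y)).trans (abs_le_norm_rayPoint c d y)
  · have hre := Complex.re_le_norm (rayPoint c d y)
    rw [rayPoint_re] at hre
    nlinarith

theorem norm_I_sub_le {d : ℝ} (hd0 : 0 ≤ d) (hd : d ≤ 1) : ‖(I - d : ℂ)‖ ≤ 2 := by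
  refine (norm_sub_le _ _).trans ?_
  rw [Complex.norm_I, Complex.norm_real, Real.norm_of_nonneg hd0]
  linarith

theorem norm_rayPoint_le {c d y : ℝ} (hc : 0 ≤ c) (hd0 : 0 ≤ d) (hd : d ≤ 1) (hy : 0 ≤ y) :
    ‖rayPoint c d y‖ ≤ c + 2 * y := by
  refine (norm_add_le _ _).trans ?_
  rw [norm_mul, Complex.norm_real, Complex.norm_real, Real.norm_of_nonneg hc,
    Real.norm_of_nonneg hy]
  nlinarith [norm_I_sub_le hd0 hd]

theorem hasDerivAt_rayPoint (c d y : ℝ) : HasDerivAt (rayPoint c d) (I - d) y :=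
  ((((hasDerivAt_id (y : ℂ)).mul_const (I - d)).const_add (c : ℂ)).comp_ofReal).congr_deriv
    (one_mul _)

theorem continuous_rayPoint (c d : ℝ) : Continuous (rayPoint c d) := by
  unfold rayPoint; fun_prop

theorem rayPoint_mem_ball {c d y R : ℝ} (hc : 0 < c) (hd0 : 0 ≤ d) (hd : d ≤ 1)
    (hy : 0 ≤ y) (hyR : y ≤ R) :
    rayPoint c d y ∈ Metric.ball (c + R * I : ℂ) (√(R ^ 2 + c ^ 2 / 2)) := by
  rw [mem_ball_iff_norm, Complex.norm_eq_sqrt_sq_add_sq]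
  refine Real.sqrt_lt_sqrt (by positivity) ?_
  have hre : (rayPoint c d y - (c + R * I)).re = -(d * y) := by simp
  have him : (rayPoint c d y - (c + R * I)).im = y - R := by simp
  rw [hre, him]
  have : d ^ 2 * y ^ 2 ≤ 1 * y ^ 2 := by gcongr; nlinarith
  nlinarith [sq_pos_of_pos hc, mul_nonneg hy (sub_nonneg.2 hyR)]

theorem ball_subset_slitPlane {c R : ℝ} (hc : 0 < c) :
    Metric.ball (c + R * I : ℂ) (√(R ^ 2 + c ^ 2 / 2)) ⊆ slitPlane := by
  intro z hz
  rw [mem_ball_iff_norm, Complex.norm_eq_sqrt_sq_add_sq] at hz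
  have hz := (Real.sqrt_lt_sqrt_iff (by positivity)).1 hz
  rw [Complex.mem_slitPlane_iff]
  by_contra! h
  have hre : (z - (c + R * I)).re = z.re - c := by simp
  have him : (z - (c + R * I)).im = -R := by simp [h.2]
  rw [hre, him, neg_sq] at hz
  nlinarith [sq_pos_of_pos hc]

/-- The rays of slopes `0` and `d`, cut off at height `R`, lie in a disc inside the slit plane, on
which `G` has a primitive; only the segment joining their upper ends contributes. -/
theorem norm_integral_ray_sub_integral_vertical_le {G : ℂ → ℂ} {c d R M : ℝ} (hc : 0 < c)
    (hd0 : 0 ≤ d) (hd : d ≤ 1) (hR : 0 ≤ R) (hG : DifferentiableOn ℂ G slitPlane)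
    (hM : ∀ e ∈ Icc 0 d, ‖G (rayPoint c e R)‖ ≤ M) :
    ‖(∫ y in (0 : ℝ)..R, G (rayPoint c d y) * (I - d)) -
      ∫ y in (0 : ℝ)..R, G (rayPoint c 0 y) * I‖ ≤ M * R * d := by
  obtain ⟨P, hP⟩ := (hG.mono (ball_subset_slitPlane (R := R) hc)).isExactOn_ball
  have hftc : ∀ e ∈ Icc 0 d,
      ∫ y in (0 : ℝ)..R, G (rayPoint c e y) * (I - e) = P (rayPoint c e R) - P c := by
    rintro e ⟨he, he'⟩
    rw [intervalIntegral.integral_eq_sub_of_hasDerivAt (f := fun y => P (rayPoint c e y)),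
      rayPoint_zero_right]
    · intro y hy
      rw [uIcc_of_le hR] at hy
      exact (hP _ (rayPoint_mem_ball hc he (he'.trans hd) hy.1 hy.2)).comp_of_eq y
        (hasDerivAt_rayPoint c e y) rfl
    · exact ((hG.continuousOn.comp_continuous (continuous_rayPoint c e)
        fun y => rayPoint_mem_slitPlane hc e y).mul continuous_const).intervalIntegrable _ _
  have hvert := hftc 0 ⟨le_rfl, hd0⟩
  simp only [Complex.ofReal_zero, sub_zero] at hvert
  rw [hftc d ⟨hd0, le_rfl⟩, hvert, sub_sub_sub_cancel_right]
  have hend : ∀ e : ℝ, HasDerivAt (fun e : ℝ => rayPoint c e R) (-R : ℂ) e := fun e =>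
    (((((hasDerivAt_id (e : ℂ)).const_sub I).const_mul (R : ℂ)).const_add
      (c : ℂ)).comp_ofReal).congr_deriv (mul_neg_one _)
  have hmvt := (convex_Icc (0 : ℝ) d).norm_image_sub_le_of_norm_hasDerivWithin_le
    (f := fun e : ℝ => P (rayPoint c e R)) (C := M * R)
    (fun e he => ((hP _ (rayPoint_mem_ball hc he.1 (he.2.trans hd) hR le_rfl)).comp_of_eq e
      (hend e) rfl).hasDerivWithinAt)
    (fun e he => by
      rw [norm_mul, norm_neg, Complex.norm_real, Real.norm_of_nonneg hR]
      exact mul_le_mul_of_nonneg_right (hM e he) hR)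
    ⟨le_rfl, hd0⟩ ⟨hd0, le_rfl⟩
  simpa [abs_of_nonneg hd0] using hmvt

/-- Decay of order `s` on the part of the sector `-d‖t‖ ≤ re t` that lies to the left of the line
`re t = c` and outside the disc of radius `c / 2`. That region contains the rays from `c` of slope
at most `d ≤ 1`. -/
def SectorDecay (G : ℂ → ℂ) (c d s K : ℝ) : Prop :=
  ∀ t : ℂ, c / 2 ≤ ‖t‖ → t.re ≤ c → -d * ‖t‖ ≤ t.re → ‖G t‖ ≤ K * ‖t‖ ^ (-s)

theorem tendsto_mul_one_add_sq_rpow {s : ℝ} (hs : 1 < s) :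
    Tendsto (fun R : ℝ => R * (1 + R ^ 2) ^ (-s / 2)) atTop (𝓝 0) := by
  refine squeeze_zero' ?_ ?_ (tendsto_rpow_neg_atTop (sub_pos.2 hs))
  · filter_upwards [eventually_ge_atTop 0] with R hR
    positivity
  · filter_upwards [eventually_gt_atTop 0] with R hR
    calc R * (1 + R ^ 2) ^ (-s / 2) ≤ R * (R ^ 2) ^ (-s / 2) := by
          refine mul_le_mul_of_nonneg_left ?_ hR.le
          exact Real.rpow_le_rpow_of_nonpos (by positivity) (by linarith) (by linarith)
      _ = R ^ (-(s - 1)) := by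
          rw [← Real.rpow_natCast R 2, ← Real.rpow_mul hR.le, ← Real.rpow_one_add' hR.le]
          · congr 1; push_cast; ring
          · push_cast; linarith

namespace SectorDecay

variable {G : ℂ → ℂ} {c d s K : ℝ}

theorem norm_le (h : SectorDecay G c d s K) (hc : 0 < c) (hs : 0 ≤ s) {t : ℂ}
    (ht : c / 2 ≤ ‖t‖) (htc : t.re ≤ c) (htd : -d * ‖t‖ ≤ t.re) :
    ‖G t‖ ≤ K * (1 + ((c / 2) ^ 2)⁻¹) ^ (s / 2) * (1 + t.im ^ 2) ^ (-s / 2) := by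
  have ht0 : 0 < ‖t‖ := (half_pos hc).trans_le ht
  have hle := h t ht htc htd
  have hK : 0 ≤ K := nonneg_of_mul_nonneg_left ((norm_nonneg _).trans hle) (by positivity)
  rw [mul_assoc]
  exact hle.trans (mul_le_mul_of_nonneg_left
    (rpow_neg_le_mul_one_add_sq_rpow (half_pos hc) hs ht (Complex.abs_im_le_norm t)) hK)

theorem norm_rayPoint_le (h : SectorDecay G c d s K) (hc : 0 < c) (hs : 0 ≤ s) (hd : d ≤ 1)
    {e y : ℝ} (he : e ∈ Icc 0 d) (hy : 0 ≤ y) :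
    ‖G (rayPoint c e y)‖ ≤ K * (1 + ((c / 2) ^ 2)⁻¹) ^ (s / 2) * (1 + y ^ 2) ^ (-s / 2) := by
  have hyn := (le_abs_self y).trans (abs_le_norm_rayPoint c e y)
  have hey : 0 ≤ e * y := mul_nonneg he.1 hy
  have hedy : e * y ≤ d * ‖rayPoint c e y‖ :=
    mul_le_mul he.2 hyn hy (he.1.trans he.2)
  simpa only [rayPoint_im] using h.norm_le hc hs (half_le_norm_rayPoint (he.2.trans hd) hy)
    (by rw [rayPoint_re]; linarith) (by rw [rayPoint_re]; linarith)

theorem integrableOn_ray (h : SectorDecay G c d s K) (hc : 0 < c) (hs : 1 < s) (hd : d ≤ 1)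
    (hG : ContinuousOn G slitPlane) {e : ℝ} (he : e ∈ Icc 0 d) :
    IntegrableOn (fun y => G (rayPoint c e y)) (Ioi 0) := by
  refine ((integrable_one_add_sq_rpow hs).const_mul
    (K * (1 + ((c / 2) ^ 2)⁻¹) ^ (s / 2))).integrableOn.mono'
    (hG.comp_continuous (continuous_rayPoint c e)
      fun y => rayPoint_mem_slitPlane hc e y).aestronglyMeasurable ?_
  filter_upwards [ae_restrict_mem measurableSet_Ioi] with y (hy : 0 < y)
  exact h.norm_rayPoint_le hc (by linarith) hd he hy.le

theorem integrable_vertical (h : SectorDecay G c d s K) (hc : 0 < c) (hs : 1 < s) (hd0 : 0 ≤ d)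
    (hG : ContinuousOn G slitPlane) : Integrable fun y : ℝ => G (c + y * I) := by
  refine ((integrable_one_add_sq_rpow hs).const_mul
    (K * (1 + ((c / 2) ^ 2)⁻¹) ^ (s / 2))).mono'
    (hG.comp_continuous (by fun_prop) (add_mul_I_mem_slitPlane hc)).aestronglyMeasurable
    (Eventually.of_forall fun y => ?_)
  have hle := h.norm_le hc (by linarith) (t := c + y * I)
    ((half_le_self hc.le).trans (le_norm_add_mul_I c y)) (by simp)
  have him : (c + y * I : ℂ).im = y := by simp
  rw [him] at hle
  refine hle (le_trans ?_ (hc.le.trans_eq (by simp)))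
  rw [neg_mul, neg_nonpos]
  positivity

theorem integral_ray_eq_integral_vertical (h : SectorDecay G c d s K) (hc : 0 < c) (hs : 1 < s)
    (hd0 : 0 ≤ d) (hd : d ≤ 1) (hG : DifferentiableOn ℂ G slitPlane) :
    ∫ y in Ioi 0, G (rayPoint c d y) * (I - d) = ∫ y in Ioi 0, G (rayPoint c 0 y) * I := by
  set B := K * (1 + ((c / 2) ^ 2)⁻¹) ^ (s / 2)
  have hlim : ∀ e ∈ Icc 0 d, Tendsto
      (fun R : ℝ => ∫ y in (0 : ℝ)..R, G (rayPoint c e y) * (I - e)) atTop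
      (𝓝 (∫ y in Ioi 0, G (rayPoint c e y) * (I - e))) := fun e he =>
    intervalIntegral_tendsto_integral_Ioi 0
      ((h.integrableOn_ray hc hs hd hG.continuousOn he).mul_const _) tendsto_id
  have hvert := hlim 0 ⟨le_rfl, hd0⟩
  simp only [Complex.ofReal_zero, sub_zero] at hvert
  refine eq_of_sub_eq_zero
    (tendsto_nhds_unique ((hlim d ⟨hd0, le_rfl⟩).sub hvert) (squeeze_zero_norm'
      (a := fun R => B * d * (R * (1 + R ^ 2) ^ (-s / 2))) ?_ ?_))
  · filter_upwards [eventually_ge_atTop 0] with R hR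
    refine (norm_integral_ray_sub_integral_vertical_le hc hd0 hd hR hG
      fun e he => h.norm_rayPoint_le hc (by linarith) hd he hR).trans_eq ?_
    ring
  · simpa using (tendsto_mul_one_add_sq_rpow hs).const_mul (B * d)

theorem integral_vertical_eq_two_mul_im_ray (h : SectorDecay G c d s K) (hc : 0 < c) (hs : 1 < s)
    (hd0 : 0 ≤ d) (hd : d ≤ 1) (hG : DifferentiableOn ℂ G slitPlane)
    (hconj : ∀ t ∈ slitPlane, G (conj t) = conj (G t)) :
    ∫ y : ℝ, G (c + y * I) =
      ((2 * (∫ y in Ioi 0, G (rayPoint c d y) * (I - d)).im : ℝ) : ℂ) := by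
  have hsymm : ∀ y : ℝ, G (c + ((-y : ℝ) : ℂ) * I) = conj (G (c + y * I)) := fun y => by
    rw [← hconj _ (add_mul_I_mem_slitPlane hc y)]
    simp
  rw [integral_eq_two_mul_re_of_conj (h.integrable_vertical hc hs hd0 hG.continuousOn) hsymm,
    h.integral_ray_eq_integral_vertical hc hs hd0 hd hG, integral_mul_const, Complex.mul_I_im]
  simp only [rayPoint_zero_slope]

end SectorDecay

/-- Hankel's integrand `e^t t^{-s}` for the reciprocal Gamma function. -/
def hankelKernel (s : ℝ) (t : ℂ) : ℂ :=
  Complex.exp t * t ^ (-(s : ℂ))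

theorem differentiableOn_hankelKernel (s : ℝ) : DifferentiableOn ℂ (hankelKernel s) slitPlane := by
  intro t ht
  unfold hankelKernel
  refine DifferentiableAt.differentiableWithinAt ?_
  fun_prop (disch := assumption)

theorem norm_hankelKernel (s : ℝ) (t : ℂ) :
    ‖hankelKernel s t‖ = Real.exp t.re * ‖t‖ ^ (-s) := by
  rw [hankelKernel, norm_mul, Complex.norm_exp, ← Complex.ofReal_neg, Complex.norm_cpow_real]

theorem hankelKernel_conj (s : ℝ) {t : ℂ} (ht : t ∈ slitPlane) :
    hankelKernel s (conj t) = conj (hankelKernel s t) := by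
  rw [hankelKernel, hankelKernel, map_mul, ← Complex.exp_conj,
    Complex.conj_cpow _ _ (Complex.slitPlane_arg_ne_pi ht)]
  simp

theorem sectorDecay_hankelKernel (c d s : ℝ) :
    SectorDecay (hankelKernel s) c d s (Real.exp c) := by
  intro t _ htc _
  rw [norm_hankelKernel]
  gcongr

/-- The density `t^{s-1} e^{-ct}` of the Gamma distribution up to normalization, extended by zero to
`t ≤ 0`. Fourier inversion at `t = 1` turns its Laplace transform into the Bromwich integral. -/
def dampedPower (c s t : ℝ) : ℂ :=
  indicator (Ioi 0) (fun t : ℝ => (t : ℂ) ^ ((s : ℂ) - 1) * Complex.exp (-(c * t))) t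

theorem fourier_dampedPower {c s : ℝ} (hc : 0 < c) (hs : 0 < s) (w : ℝ) :
    𝓕 (dampedPower c s) w =
      (c + (2 * π * w : ℝ) * I : ℂ) ^ (-(s : ℂ)) * Real.Gamma s := by
  rw [Real.fourier_real_eq_integral_exp_smul, ← Complex.Gamma_ofReal,
    ← integral_cpow_mul_cexp_neg_mul (by simpa using hs) (by simpa using hc),
    ← integral_indicator measurableSet_Ioi]
  congr 1
  ext t
  by_cases ht : t ∈ Ioi (0 : ℝ)
  · simp only [dampedPower, indicator_of_mem ht, smul_eq_mul]
    rw [mul_left_comm, ← Complex.exp_add]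
    congr 2
    push_cast
    ring
  · simp [dampedPower, indicator_of_notMem ht]

theorem integrable_dampedPower {c s : ℝ} (hc : 0 < c) (hs : 0 < s) :
    Integrable (dampedPower c s) :=
  (integrable_indicator_iff measurableSet_Ioi).2
    (integrableOn_cpow_mul_cexp_neg_mul (by simpa using hs) (by simpa using hc))

theorem continuousAt_dampedPower (c s : ℝ) {t : ℝ} (ht : 0 < t) :
    ContinuousAt (dampedPower c s) t := by
  refine ContinuousAt.congr (f := fun t : ℝ => (t : ℂ) ^ ((s : ℂ) - 1) * Complex.exp (-(c * t)))
    ?_ ?_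
  · have : (t : ℂ) ∈ slitPlane := Complex.ofReal_mem_slitPlane.2 ht
    fun_prop (disch := assumption)
  · filter_upwards [Ioi_mem_nhds ht] with u hu
    rw [dampedPower, indicator_of_mem hu]

theorem integrable_cpow_vertical {c s : ℝ} (hc : 0 < c) (hs : 1 < s) :
    Integrable fun y : ℝ => (c + y * I : ℂ) ^ (-(s : ℂ)) := by
  have hdecay : SectorDecay (fun t => t ^ (-(s : ℂ))) c 0 s 1 := by
    intro t _ _ _
    rw [one_mul, ← Complex.ofReal_neg, Complex.norm_cpow_real]
  refine hdecay.integrable_vertical hc hs le_rfl fun t ht => ContinuousAt.continuousWithinAt ?_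
  fun_prop (disch := assumption)

theorem integral_hankelKernel_vertical {c s : ℝ} (hc : 0 < c) (hs : 1 < s) :
    ∫ y : ℝ, hankelKernel s (c + y * I) = ((2 * π / Real.Gamma s : ℝ) : ℂ) := by
  have hs0 : 0 < s := one_pos.trans hs
  have hGamma : (Real.Gamma s : ℂ) ≠ 0 := by exact_mod_cast (Real.Gamma_pos_of_pos hs0).ne'
  have hFourier : 𝓕 (dampedPower c s) =
      fun w => (c + (2 * π * w : ℝ) * I : ℂ) ^ (-(s : ℂ)) * Real.Gamma s :=
    funext (fourier_dampedPower hc hs0)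
  have hintegrable : Integrable (𝓕 (dampedPower c s)) := by
    rw [hFourier]
    exact ((integrable_cpow_vertical hc hs).comp_mul_left' (R := 2 * π)
      (by positivity)).mul_const _
  have hinv := (integrable_dampedPower hc hs0).fourierInv_fourier_eq hintegrable
    (continuousAt_dampedPower c s one_pos)
  have hone : dampedPower c s 1 = Complex.exp (-c) := by
    rw [dampedPower, indicator_of_mem (by simp)]
    simp
  rw [hFourier, hone, Real.fourierInv_eq'] at hinv
  have hscaled : Complex.exp c * Complex.exp (-c) =
      (∫ w : ℝ, hankelKernel s (c + (2 * π * w : ℝ) * I)) * Real.Gamma s := by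
    rw [← hinv, ← integral_const_mul, ← integral_mul_const]
    congr 1
    ext w
    simp only [hankelKernel, Complex.exp_add, smul_eq_mul]
    rw [show (2 * π * inner ℝ w 1 : ℝ) = 2 * π * w by simp]
    ring
  rw [Measure.integral_comp_mul_left (fun y : ℝ => hankelKernel s (c + y * I)),
    abs_of_pos (by positivity), ← Complex.exp_add, add_neg_cancel, Complex.exp_zero,
    Complex.real_smul] at hscaled
  have hpi : (π : ℂ) ≠ 0 := by exact_mod_cast Real.pi_ne_zero
  rw [Complex.ofReal_div, eq_div_iff hGamma]
  push_cast at hscaled ⊢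
  generalize ∫ y : ℝ, hankelKernel s (c + y * I) = J at hscaled ⊢
  field_simp at hscaled
  exact hscaled.symm

/-! ### The Hankel type integral of the Wright function -/

theorem tendsto_rpow_mul_exp_rpow_mul_exp_neg {ε q : ℝ} (hε : 0 < ε) (hq : q < 1) (p K : ℝ) :
    Tendsto (fun r : ℝ => r ^ p * Real.exp (K * r ^ q) * Real.exp (-(ε * r))) atTop (𝓝 0) := by
  have hdominated : ∀ᶠ r : ℝ in atTop, K * r ^ (-(1 - q)) ≤ ε / 2 := by
    have hpow := (tendsto_rpow_neg_atTop (sub_pos.2 hq)).const_mul K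
    rw [mul_zero] at hpow
    exact hpow.eventually_le_const (by positivity)
  refine squeeze_zero' ?_ ?_
    (tendsto_rpow_mul_exp_neg_mul_atTop_nhds_zero p (ε / 2) (half_pos hε))
  · filter_upwards [eventually_ge_atTop 0] with r hr
    positivity
  · filter_upwards [hdominated, eventually_gt_atTop 0] with r hr hr0
    have hsub : K * r ^ q ≤ ε / 2 * r := by
      have hsplit : r ^ q = r ^ (-(1 - q)) * r := by
        rw [← Real.rpow_add_one hr0.ne']
        congr 1
        ring
      rw [hsplit, ← mul_assoc]
      gcongr
    rw [mul_assoc, ← Real.exp_add]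
    gcongr
    linarith

theorem exists_le_of_continuousOn_Ici_of_tendsto {f : ℝ → ℝ} {c l : ℝ}
    (hf : ContinuousOn f (Ici c)) (hlim : Tendsto f atTop (𝓝 l)) :
    ∃ C, 0 ≤ C ∧ ∀ r, c ≤ r → f r ≤ C := by
  obtain ⟨R, hR⟩ := eventually_atTop.1 (hlim.eventually_le_const (lt_add_one l))
  obtain ⟨C, hC⟩ := (isCompact_Icc (a := c) (b := R)).bddAbove_image (hf.mono Icc_subset_Ici_self)
  refine ⟨max 0 (max C (l + 1)), le_max_left _ _, fun r hr => ?_⟩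
  rcases le_total r R with hrR | hRr
  · exact (hC ⟨r, ⟨hr, hrR⟩, rfl⟩).trans ((le_max_left _ _).trans (le_max_right _ _))
  · exact (hR r hRr).trans ((le_max_right _ _).trans (le_max_right _ _))

theorem exists_rpow_mul_exp_rpow_le {c ε q : ℝ} (hc : 0 < c) (hε : 0 < ε) (hq : q < 1) (p K : ℝ) :
    ∃ C, 0 ≤ C ∧ ∀ r, c ≤ r → r ^ p * Real.exp (K * r ^ q) ≤ C * Real.exp (ε * r) := by
  have hcont : ContinuousOn (fun r : ℝ => r ^ p * Real.exp (K * r ^ q) * Real.exp (-(ε * r)))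
      (Ici c) := by
    have hpow : ∀ b : ℝ, ContinuousOn (fun r : ℝ => r ^ b) (Ici c) := fun b =>
      continuousOn_id.rpow_const fun r hr => Or.inl (hc.trans_le hr).ne'
    exact ((hpow p).mul (continuousOn_const.mul (hpow q)).rexp).mul (by fun_prop)
  obtain ⟨C, hC0, hC⟩ := exists_le_of_continuousOn_Ici_of_tendsto hcont
    (tendsto_rpow_mul_exp_rpow_mul_exp_neg hε hq p K)
  refine ⟨C, hC0, fun r hr => ?_⟩
  have hle := hC r hr
  rwa [Real.exp_neg, ← div_eq_mul_inv, div_le_iff₀ (Real.exp_pos _)] at hle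

theorem exists_ray_majorant_le {c d q : ℝ} (hc : 0 < c) (hd0 : 0 < d) (hd : d ≤ 1) (hq : q < 1)
    (p K : ℝ) :
    ∃ C, ∀ y, 0 ≤ y → Real.exp (c - d * y) *
      (‖rayPoint c d y‖ ^ p * Real.exp (K * ‖rayPoint c d y‖ ^ q)) ≤
        C * Real.exp (-(d / 2) * y) := by
  obtain ⟨C, hC0, hC⟩ :=
    exists_rpow_mul_exp_rpow_le (half_pos hc) (show 0 < d / 4 by positivity) hq p K
  refine ⟨C * Real.exp (c + d / 4 * c), fun y hy => ?_⟩
  calc Real.exp (c - d * y) * (‖rayPoint c d y‖ ^ p * Real.exp (K * ‖rayPoint c d y‖ ^ q))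
      ≤ Real.exp (c - d * y) * (C * Real.exp (d / 4 * ‖rayPoint c d y‖)) :=
        mul_le_mul_of_nonneg_left (hC _ (half_le_norm_rayPoint hd hy)) (Real.exp_pos _).le
    _ ≤ Real.exp (c - d * y) * (C * Real.exp (d / 4 * (c + 2 * y))) := by
        gcongr
        exact norm_rayPoint_le hc.le hd0.le hd hy
    _ = C * Real.exp (c + d / 4 * c) * Real.exp (-(d / 2) * y) := by
        rw [mul_left_comm, ← Real.exp_add, mul_assoc, ← Real.exp_add]
        ring_nf

theorem integrableOn_ray_majorant {c d q : ℝ} (hc : 0 < c) (hd0 : 0 < d) (hd : d ≤ 1)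
    (hq : q < 1) (p K : ℝ) :
    IntegrableOn (fun y : ℝ => Real.exp (c - d * y) * (‖rayPoint c d y‖ ^ p *
      Real.exp (K * ‖rayPoint c d y‖ ^ q))) (Ioi 0) := by
  obtain ⟨C, hC⟩ := exists_ray_majorant_le hc hd0 hd hq p K
  have hpow : ∀ b : ℝ, Continuous fun y => ‖rayPoint c d y‖ ^ b := fun b =>
    (continuous_rayPoint c d).norm.rpow_const fun y =>
      Or.inl (norm_ne_zero_iff.2 (Complex.slitPlane_ne_zero (rayPoint_mem_slitPlane hc d y)))
  refine ((exp_neg_integrableOn_Ioi 0 (half_pos hd0)).const_mul C).mono'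
    (Continuous.aestronglyMeasurable (by have := hpow p; have := hpow q; fun_prop)) ?_
  filter_upwards [ae_restrict_mem measurableSet_Ioi] with y (hy : 0 < y)
  rw [Real.norm_of_nonneg (by positivity)]
  exact hC y hy.le

theorem norm_hankelKernel_rayPoint (s c d y : ℝ) :
    ‖hankelKernel s (rayPoint c d y)‖ = Real.exp (c - d * y) * ‖rayPoint c d y‖ ^ (-s) := by
  rw [norm_hankelKernel, rayPoint_re]

theorem continuous_hankelKernel_rayPoint {c : ℝ} (hc : 0 < c) (d s : ℝ) :
    Continuous fun y => hankelKernel s (rayPoint c d y) :=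
  (differentiableOn_hankelKernel s).continuousOn.comp_continuous (continuous_rayPoint c d)
    fun y => rayPoint_mem_slitPlane hc d y

theorem integrableOn_hankelKernel_ray {c d : ℝ} (hc : 0 < c) (hd0 : 0 < d) (hd : d ≤ 1) (s : ℝ) :
    IntegrableOn (fun y : ℝ => hankelKernel s (rayPoint c d y)) (Ioi 0) := by
  refine (integrableOn_ray_majorant hc hd0 hd zero_lt_one (-s) 0).mono'
    (continuous_hankelKernel_rayPoint hc d s).aestronglyMeasurable
    (Eventually.of_forall fun y => le_of_eq ?_)
  rw [norm_hankelKernel_rayPoint]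
  simp

theorem tendsto_hankelKernel_ray {c d : ℝ} (hc : 0 < c) (hd0 : 0 < d) (hd : d ≤ 1) (s : ℝ) :
    Tendsto (fun y : ℝ => hankelKernel s (rayPoint c d y)) atTop (𝓝 0) := by
  obtain ⟨C, hC⟩ := exists_ray_majorant_le hc hd0 hd zero_lt_one (-s) 0
  refine squeeze_zero_norm' (a := fun y => C * Real.exp (-(d / 2) * y)) ?_ ?_
  · filter_upwards [eventually_ge_atTop 0] with y hy
    simpa [norm_hankelKernel_rayPoint] using hC y hy
  · have hexp : Tendsto (fun y : ℝ => Real.exp (-(d / 2) * y)) atTop (𝓝 0) :=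
      Real.tendsto_exp_atBot.comp (tendsto_id.const_mul_atTop_of_neg (by linarith))
    simpa using hexp.const_mul C

theorem hasDerivAt_hankelKernel (s : ℝ) {t : ℂ} (ht : t ∈ slitPlane) :
    HasDerivAt (hankelKernel s) (hankelKernel s t - s * hankelKernel (s + 1) t) t := by
  refine ((Complex.hasDerivAt_exp t).mul
    ((hasDerivAt_id t).cpow_const (c := -(s : ℂ)) ht)).congr_deriv ?_
  simp only [hankelKernel, id, mul_one, Complex.ofReal_add, Complex.ofReal_one, neg_add']
  ring

theorem im_integral_hankelKernel_ray_of_one_lt {c d s : ℝ} (hc : 0 < c) (hd0 : 0 ≤ d) (hd : d ≤ 1)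
    (hs : 1 < s) :
    (∫ y in Ioi 0, hankelKernel s (rayPoint c d y) * (I - d)).im = π / Real.Gamma s := by
  have hcontour := (sectorDecay_hankelKernel c d s).integral_vertical_eq_two_mul_im_ray hc hs hd0 hd
    (differentiableOn_hankelKernel s) fun t ht => hankelKernel_conj s ht
  rw [integral_hankelKernel_vertical hc hs, Complex.ofReal_inj] at hcontour
  linear_combination -hcontour / 2

theorem im_integral_hankelKernel_ray_eq_mul {c d : ℝ} (hc : 0 < c) (hd0 : 0 < d) (hd : d ≤ 1)
    (s : ℝ) :
    (∫ y in Ioi 0, hankelKernel s (rayPoint c d y) * (I - d)).im =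
      s * (∫ y in Ioi 0, hankelKernel (s + 1) (rayPoint c d y) * (I - d)).im := by
  have hint := fun s => (integrableOn_hankelKernel_ray hc hd0 hd s).mul_const (I - d)
  have hderiv : ∀ y ∈ Ici (0 : ℝ), HasDerivAt (fun y : ℝ => hankelKernel s (rayPoint c d y))
      (hankelKernel s (rayPoint c d y) * (I - d) -
        s * (hankelKernel (s + 1) (rayPoint c d y) * (I - d))) y := fun y _ =>
    ((hasDerivAt_hankelKernel s (rayPoint_mem_slitPlane hc d y)).comp_of_eq y
      (hasDerivAt_rayPoint c d y) rfl).congr_deriv (by ring)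
  have hparts := integral_Ioi_of_hasDerivAt_of_tendsto' hderiv
    ((hint s).sub ((hint (s + 1)).const_mul (s : ℂ))) (tendsto_hankelKernel_ray hc hd0 hd s)
  rw [integral_sub (hint s) ((hint (s + 1)).const_mul (s : ℂ)), integral_const_mul,
    rayPoint_zero_right, zero_sub] at hparts
  have hreal : (hankelKernel s c).im = 0 := by
    rw [hankelKernel, ← Complex.ofReal_neg, ← Complex.ofReal_cpow hc.le, ← Complex.ofReal_exp,
      ← Complex.ofReal_mul, Complex.ofReal_im]
  have him := congrArg Complex.im hparts
  rw [Complex.sub_im, Complex.im_ofReal_mul, Complex.neg_im, hreal] at him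
  linarith

theorem inv_Gamma_eq_mul_inv_Gamma_add_one (s : ℝ) :
    (Real.Gamma s)⁻¹ = s * (Real.Gamma (s + 1))⁻¹ := by
  rcases eq_or_ne s 0 with rfl | hs
  · simp
  · rw [Real.Gamma_add_one hs, mul_inv, mul_inv_cancel_left₀ hs]

/-- Both sides satisfy `F s = s * F (s + 1)`, which carries the formula from `1 < s` to all real
`s`, the poles of `Γ` included. -/
theorem im_integral_hankelKernel_ray {c d : ℝ} (hc : 0 < c) (hd0 : 0 < d) (hd : d ≤ 1) (s : ℝ) :
    (∫ y in Ioi 0, hankelKernel s (rayPoint c d y) * (I - d)).im = π / Real.Gamma s := by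
  obtain ⟨n, hn⟩ := exists_nat_gt (1 - s)
  induction n generalizing s with
  | zero =>
    exact im_integral_hankelKernel_ray_of_one_lt hc hd0.le hd (by push_cast at hn; linarith)
  | succ n ih =>
    rw [im_integral_hankelKernel_ray_eq_mul hc hd0 hd,
      ih (s + 1) (by push_cast at hn; linarith), div_eq_mul_inv, div_eq_mul_inv,
      inv_Gamma_eq_mul_inv_Gamma_add_one s]
    ring

/-- The integrand `exp (t + z t^{-λ}) t^{-μ}` of the Hankel type integral of the Wright
function. -/
def wrightKernel (lam mu z : ℝ) (t : ℂ) : ℂ :=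
  Complex.exp (z * t ^ (-(lam : ℂ))) * hankelKernel mu t

theorem differentiableOn_wrightKernel (lam mu z : ℝ) :
    DifferentiableOn ℂ (wrightKernel lam mu z) slitPlane := by
  refine DifferentiableOn.mul (fun t ht => DifferentiableAt.differentiableWithinAt ?_)
    (differentiableOn_hankelKernel mu)
  fun_prop (disch := assumption)

theorem wrightKernel_conj (lam mu z : ℝ) {t : ℂ} (ht : t ∈ slitPlane) :
    wrightKernel lam mu z (conj t) = conj (wrightKernel lam mu z t) := by
  rw [wrightKernel, wrightKernel, hankelKernel_conj mu ht, map_mul, ← Complex.exp_conj, map_mul,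
    Complex.conj_cpow _ _ (Complex.slitPlane_arg_ne_pi ht)]
  simp

theorem hankelKernel_mul_natCast_add (lam mu : ℝ) {t : ℂ} (ht : t ≠ 0) (n : ℕ) :
    hankelKernel (lam * n + mu) t = (t ^ (-(lam : ℂ))) ^ n * hankelKernel mu t := by
  rw [hankelKernel, hankelKernel, mul_left_comm, ← Complex.cpow_nat_mul, ← Complex.cpow_add _ _ ht]
  congr 2
  push_cast
  ring

theorem hasSum_hankelKernel (lam mu z : ℝ) {t : ℂ} (ht : t ≠ 0) :
    HasSum (fun n : ℕ => ((z ^ n / n.factorial : ℝ) : ℂ) * hankelKernel (lam * n + mu) t)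
      (wrightKernel lam mu z t) := by
  have hexp := (NormedSpace.expSeries_div_hasSum_exp (z * t ^ (-(lam : ℂ)) : ℂ)).mul_right
    (hankelKernel mu t)
  rw [← Complex.exp_eq_exp_ℂ] at hexp
  refine hexp.congr_fun fun n => ?_
  rw [hankelKernel_mul_natCast_add lam mu ht, mul_pow]
  push_cast
  ring

theorem hasSum_norm_hankelKernel_rayPoint {c : ℝ} (hc : 0 < c) (lam mu z d y : ℝ) :
    HasSum (fun n : ℕ => ‖((z ^ n / n.factorial : ℝ) : ℂ) *
        (hankelKernel (lam * n + mu) (rayPoint c d y) * (I - d))‖)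
      (Real.exp (c - d * y) * (‖rayPoint c d y‖ ^ (-mu) *
        Real.exp (|z| * ‖rayPoint c d y‖ ^ (-lam))) * ‖(I - d : ℂ)‖) := by
  have hne := Complex.slitPlane_ne_zero (rayPoint_mem_slitPlane hc d y)
  have hexp := (NormedSpace.expSeries_div_hasSum_exp (|z| * ‖rayPoint c d y‖ ^ (-lam))).mul_left
    (Real.exp (c - d * y) * ‖rayPoint c d y‖ ^ (-mu) * ‖(I - d : ℂ)‖)
  rw [← Real.exp_eq_exp_ℝ] at hexp
  convert! hexp using 1
  · ext n
    rw [hankelKernel_mul_natCast_add lam mu hne, norm_mul, norm_mul, norm_mul, norm_pow,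
      norm_hankelKernel_rayPoint, Complex.norm_real, norm_div, norm_pow, Real.norm_eq_abs,
      RCLike.norm_natCast, ← Complex.ofReal_neg, Complex.norm_cpow_real, mul_pow]
    ring
  · ring

theorem hasSum_integral_hankelKernel_ray {lam c d : ℝ} (hlam : -1 < lam) (hc : 0 < c) (hd0 : 0 < d)
    (hd : d ≤ 1) (mu z : ℝ) :
    HasSum (fun n : ℕ => ∫ y in Ioi 0, ((z ^ n / n.factorial : ℝ) : ℂ) *
        (hankelKernel (lam * n + mu) (rayPoint c d y) * (I - d)))
      (∫ y in Ioi 0, wrightKernel lam mu z (rayPoint c d y) * (I - d)) := by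
  refine hasSum_integral_of_dominated_convergence
    (fun n y => ‖((z ^ n / n.factorial : ℝ) : ℂ) *
      (hankelKernel (lam * n + mu) (rayPoint c d y) * (I - d))‖) (fun n => ?_)
    (fun n => Eventually.of_forall fun y => le_rfl)
    (Eventually.of_forall fun y =>
      (hasSum_norm_hankelKernel_rayPoint hc lam mu z d y).summable) ?_
    (Eventually.of_forall fun y => ?_)
  · exact (((continuous_hankelKernel_rayPoint hc d _).mul_const _).const_mul _)
      |>.aestronglyMeasurable
  · simp only [(hasSum_norm_hankelKernel_rayPoint hc lam mu z d _).tsum_eq]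
    exact (integrableOn_ray_majorant hc hd0 hd (by linarith) _ _).mul_const _
  · simpa only [mul_assoc] using (hasSum_hankelKernel lam mu z
      (Complex.slitPlane_ne_zero (rayPoint_mem_slitPlane hc d y))).mul_right (I - d)

theorem hasSum_wright_ray {lam c d : ℝ} (hlam : -1 < lam) (hc : 0 < c) (hd0 : 0 < d) (hd : d ≤ 1)
    (mu z : ℝ) :
    HasSum (fun n : ℕ => z ^ n / ((n.factorial : ℝ) * Real.Gamma (lam * n + mu)))
      ((∫ y in Ioi 0, wrightKernel lam mu z (rayPoint c d y) * (I - d)).im / π) := by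
  refine ((Complex.hasSum_im (hasSum_integral_hankelKernel_ray hlam hc hd0 hd mu z)).div_const
    π).congr_fun fun n => ?_
  rw [integral_const_mul, Complex.im_ofReal_mul, im_integral_hankelKernel_ray hc hd0 hd,
    mul_div_assoc, div_div_cancel_left' Real.pi_ne_zero, ← div_eq_mul_inv, div_div]

theorem summable_wright {lam : ℝ} (hlam : -1 < lam) (mu z : ℝ) :
    Summable fun n : ℕ => z ^ n / ((n.factorial : ℝ) * Real.Gamma (lam * n + mu)) :=
  (hasSum_wright_ray hlam one_pos one_pos le_rfl mu z).summable

theorem cpow_re_nonneg_of_sector {m : ℝ} (hm0 : 0 < m) (hm : m < 1) {t : ℂ} (ht : t ≠ 0)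
    (hsector : Real.cos (π / 2 * (2 - m)) * ‖t‖ ≤ t.re) : 0 ≤ (t ^ (m : ℂ)).re := by
  have hpi := Real.pi_pos
  have hcos : Real.cos (π / 2 * (2 - m)) ≤ Real.cos |t.arg| := by
    rwa [Real.cos_abs, Complex.cos_arg ht, le_div_iff₀ (norm_pos_iff.2 ht)]
  have harg : |t.arg| ≤ π / 2 * (2 - m) :=
    (Real.strictAntiOn_cos.le_iff_ge ⟨by nlinarith, by nlinarith⟩
      ⟨abs_nonneg _, Complex.abs_arg_le_pi t⟩).1 hcos
  rw [Complex.cpow_ofReal_re, ← Real.cos_abs, abs_mul, abs_of_pos hm0]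
  refine mul_nonneg (by positivity) (Real.cos_nonneg_of_mem_Icc ⟨?_, ?_⟩)
  · have : 0 ≤ |t.arg| * m := by positivity
    linarith
  · have : |t.arg| * m ≤ π / 2 * (2 - m) * m := by gcongr
    nlinarith [sq_nonneg (1 - m)]

/-- For `λ ≥ 0` the factor is bounded because `t^{-λ}` is; for `-1 < λ < 0` because `t^{-λ}` has
nonnegative real part in a sector wider than the right half plane. -/
theorem exists_norm_exp_cpow_le {lam z c : ℝ} (hlam : -1 < lam) (hz : z ≤ 0) (hc : 0 < c) :
    ∃ d, 0 < d ∧ d ≤ 1 ∧ ∃ C, ∀ t : ℂ, c ≤ ‖t‖ → -d * ‖t‖ ≤ t.re →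
      ‖Complex.exp (z * t ^ (-(lam : ℂ)))‖ ≤ C := by
  rcases le_or_gt 0 lam with hlam0 | hlam0
  · refine ⟨1, one_pos, le_rfl, Real.exp (‖z‖ * c ^ (-lam)), fun t ht _ => ?_⟩
    refine (Complex.norm_exp_le_exp_norm _).trans ?_
    rw [norm_mul, ← Complex.ofReal_neg, Complex.norm_cpow_real, Complex.norm_real]
    exact Real.exp_le_exp.2 (mul_le_mul_of_nonneg_left
      (Real.rpow_le_rpow_of_nonpos hc ht (neg_nonpos.2 hlam0)) (norm_nonneg _))
  · have hpi := Real.pi_pos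
    refine ⟨-Real.cos (π / 2 * (2 - -lam)), ?_, ?_, 1, fun t ht hsector => ?_⟩
    · exact neg_pos.2 (Real.cos_neg_of_pi_div_two_lt_of_lt (by nlinarith) (by nlinarith))
    · linarith [Real.neg_one_le_cos (π / 2 * (2 - -lam))]
    · rw [neg_neg] at hsector
      have hre := cpow_re_nonneg_of_sector (neg_pos.2 hlam0) (neg_lt.1 hlam)
        (norm_pos_iff.1 (hc.trans_le ht)) hsector
      rw [Complex.ofReal_neg] at hre
      rw [Complex.norm_exp, Complex.re_ofReal_mul]
      exact Real.exp_le_one_iff.2 (mul_nonpos_of_nonpos_of_nonneg hz hre)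

theorem exists_sectorDecay_wrightKernel {lam z c : ℝ} (hlam : -1 < lam) (hz : z ≤ 0) (hc : 0 < c)
    (mu : ℝ) : ∃ d, 0 < d ∧ d ≤ 1 ∧ ∃ K, SectorDecay (wrightKernel lam mu z) c d mu K := by
  obtain ⟨d, hd0, hd, C, hC⟩ := exists_norm_exp_cpow_le hlam hz (half_pos hc)
  refine ⟨d, hd0, hd, C * Real.exp c, fun t ht htc hsector => ?_⟩
  rw [wrightKernel, norm_mul, mul_assoc]
  have hexp := hC t ht hsector
  exact mul_le_mul hexp (sectorDecay_hankelKernel c d mu t ht htc hsector) (norm_nonneg _)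
    ((norm_nonneg _).trans hexp)

theorem integrable_wrightKernel_vertical {lam mu z c : ℝ} (hlam : -1 < lam) (hmu : 1 < mu)
    (hz : z ≤ 0) (hc : 0 < c) : Integrable fun y : ℝ => wrightKernel lam mu z (c + y * I) := by
  obtain ⟨d, hd0, -, K, hdecay⟩ := exists_sectorDecay_wrightKernel hlam hz hc mu
  exact hdecay.integrable_vertical hc hmu hd0.le
    (differentiableOn_wrightKernel lam mu z).continuousOn

theorem integral_wrightKernel_vertical {lam mu z c : ℝ} (hlam : -1 < lam) (hmu : 1 < mu)
    (hz : z ≤ 0) (hc : 0 < c) :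
    ∫ y : ℝ, wrightKernel lam mu z (c + y * I) = ((2 * π * wrightW lam mu z : ℝ) : ℂ) := by
  obtain ⟨d, hd0, hd, K, hdecay⟩ := exists_sectorDecay_wrightKernel hlam hz hc mu
  rw [hdecay.integral_vertical_eq_two_mul_im_ray hc hmu hd0.le hd
    (differentiableOn_wrightKernel lam mu z) fun t ht => wrightKernel_conj lam mu z ht,
    wrightW, (hasSum_wright_ray hlam hc hd0 hd mu z).tsum_eq, mul_assoc,
    mul_div_cancel₀ _ Real.pi_ne_zero]

/-! ### Real saddle points -/

/-- The left hand side `e^u + λ e^{-λu} = 2 h'(u) + 2a` of the saddle point equation. -/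
def saddleFun (lam u : ℝ) : ℝ := Real.exp u + lam * Real.exp (-lam * u)

theorem hasDerivAt_saddleFun (lam u : ℝ) :
    HasDerivAt (saddleFun lam) (Real.exp u - lam ^ 2 * Real.exp (-lam * u)) u := by
  refine ((Real.hasDerivAt_exp u).add
    ((((hasDerivAt_id u).const_mul (-lam)).exp).const_mul lam)).congr_deriv ?_
  simp only [id]
  ring

theorem continuous_saddleFun (lam : ℝ) : Continuous (saddleFun lam) := by
  unfold saddleFun; fun_prop

theorem tendsto_saddleFun_atTop {lam : ℝ} (hlam : -1 < lam) :
    Tendsto (saddleFun lam) atTop atTop := by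
  rcases le_or_gt 0 lam with hlam0 | hlam0
  · refine tendsto_atTop_mono (fun u => ?_) Real.tendsto_exp_atTop
    exact le_add_of_nonneg_right (by positivity)
  · refine tendsto_atTop_mono' _ ?_
      (Real.tendsto_exp_atTop.const_mul_atTop (show 0 < 1 + lam by linarith))
    filter_upwards [eventually_ge_atTop 0] with u hu
    have hexp : Real.exp (-lam * u) ≤ Real.exp u := by
      gcongr
      nlinarith
    rw [saddleFun]
    nlinarith

theorem tendsto_saddleFun_atBot {lam : ℝ} (hlam : 0 < lam) :
    Tendsto (saddleFun lam) atBot atTop :=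
  tendsto_atTop_mono (fun _ => le_add_of_nonneg_left (Real.exp_pos _).le)
    ((Real.tendsto_exp_atTop.comp
      (tendsto_id.const_mul_atBot_of_neg (neg_neg_of_pos hlam))).const_mul_atTop hlam)

theorem exists_saddleFun_eq_of_neg {lam b : ℝ} (hlam : -1 < lam) (hlam0 : lam < 0) (hb : 0 < b) :
    ∃ u, saddleFun lam u = b := by
  refine mem_range_of_exists_le_of_exists_ge (continuous_saddleFun lam) ⟨Real.log b, ?_⟩
    ((tendsto_saddleFun_atTop hlam).eventually_ge_atTop b).exists
  rw [saddleFun, Real.exp_log hb]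
  nlinarith [Real.exp_pos (-lam * Real.log b)]

/-- `saddleFun` is not monotone for `-1 < λ < 0`, but it increases once it is positive: both factors
of `e^{-λu} (e^{(1+λ)u} + λ)` do. -/
theorem saddleFun_lt_of_lt {lam u v : ℝ} (hlam : -1 < lam) (hlam0 : lam < 0)
    (hu : 0 < saddleFun lam u) (huv : u < v) : saddleFun lam u < saddleFun lam v := by
  have hfactor : ∀ u, saddleFun lam u =
      Real.exp (-lam * u) * (Real.exp ((1 + lam) * u) + lam) := fun u => by
    rw [saddleFun, mul_add, ← Real.exp_add]
    ring_nf
  rw [hfactor] at hu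
  rw [hfactor, hfactor]
  exact mul_lt_mul'' (Real.exp_lt_exp.2 (by nlinarith))
    (add_lt_add_left (Real.exp_lt_exp.2 (by nlinarith)) lam) (Real.exp_pos _).le
    (pos_of_mul_pos_right hu (Real.exp_pos _).le).le

theorem exists_realSaddles_eq_singleton {lam a : ℝ} (ha : 0 < a) (hlam : -1 < lam)
    (hlam0 : lam < 0) : ∃ u0, realSaddles lam a = {u0} := by
  obtain ⟨u0, hu0⟩ := exists_saddleFun_eq_of_neg hlam hlam0 (mul_pos two_pos ha)
  refine ⟨u0, Set.eq_singleton_iff_unique_mem.2 ⟨hu0, fun v (hv : saddleFun lam v = 2 * a) => ?_⟩⟩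
  rcases lt_trichotomy v u0 with hlt | heq | hgt
  · exact absurd (saddleFun_lt_of_lt hlam hlam0 (by linarith) hlt) (by linarith)
  · exact heq
  · exact absurd (saddleFun_lt_of_lt hlam hlam0 (by linarith) hgt) (by linarith)

theorem exists_setOf_eq_eq_pair {f : ℝ → ℝ} {c b : ℝ} (hf : Continuous f)
    (hanti : StrictAntiOn f (Iic c)) (hmono : StrictMonoOn f (Ici c))
    (hbot : Tendsto f atBot atTop) (htop : Tendsto f atTop atTop) (hb : f c < b) :
    ∃ u v, u < c ∧ c < v ∧ {x | f x = b} = {u, v} := by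
  obtain ⟨p, hpb, hpc⟩ := ((hbot.eventually_ge_atTop b).and (eventually_le_atBot c)).exists
  obtain ⟨q, hqb, hqc⟩ := ((htop.eventually_ge_atTop b).and (eventually_ge_atTop c)).exists
  obtain ⟨u, ⟨-, huc⟩, hu⟩ := intermediate_value_Icc' hpc hf.continuousOn ⟨hb.le, hpb⟩
  obtain ⟨v, ⟨hcv, -⟩, hv⟩ := intermediate_value_Icc hqc hf.continuousOn ⟨hb.le, hqb⟩
  refine ⟨u, v, huc.lt_of_ne ?_, hcv.lt_of_ne' ?_, Set.ext fun x => ⟨fun hx => ?_, ?_⟩⟩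
  · rintro rfl
    exact hb.ne hu
  · rintro rfl
    exact hb.ne hv
  · rcases le_total c x with hcx | hxc
    · exact Or.inr (hmono.injOn hcx hcv (hx.trans hv.symm))
    · exact Or.inl (hanti.injOn hxc huc (hx.trans hu.symm))
  · rintro (rfl | rfl)
    exacts [hu, hv]

/-- The point where `saddleFun` attains its minimum when `λ > 0`. -/
def saddleTurningPoint (lam : ℝ) : ℝ := 2 * Real.log lam / (1 + lam)

theorem saddleFun_turningPoint {lam : ℝ} (hlam : 0 < lam) :
    saddleFun lam (saddleTurningPoint lam) = (1 + lam) * lam ^ ((1 - lam) / (1 + lam)) := by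
  set p := Real.log lam * ((1 - lam) / (1 + lam))
  have hexp : saddleTurningPoint lam = Real.log lam + p := by
    simp only [saddleTurningPoint, p]
    field_simp
    ring
  have hexp' : p = Real.log lam + -lam * saddleTurningPoint lam := by
    simp only [saddleTurningPoint, p]
    field_simp
    ring
  have hsecond : lam * Real.exp (-lam * saddleTurningPoint lam) = Real.exp p := by
    rw [hexp', Real.exp_add, Real.exp_log hlam]
  rw [saddleFun, hsecond, hexp, Real.exp_add, Real.exp_log hlam, Real.rpow_def_of_pos hlam]
  ring

theorem deriv_saddleFun_eq_mul {lam : ℝ} (hlam : 0 < lam) (u : ℝ) :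
    Real.exp u - lam ^ 2 * Real.exp (-lam * u) = Real.exp (-lam * u) *
      (Real.exp ((1 + lam) * u) - Real.exp ((1 + lam) * saddleTurningPoint lam)) := by
  have hturn : (1 + lam) * saddleTurningPoint lam = Real.log lam + Real.log lam := by
    rw [saddleTurningPoint]
    field_simp
    ring
  rw [hturn, Real.exp_add (Real.log lam), Real.exp_log hlam, mul_sub, ← Real.exp_add]
  ring_nf

theorem deriv_saddleFun_pos {lam u : ℝ} (hlam : 0 < lam) (hu : saddleTurningPoint lam < u) :
    0 < Real.exp u - lam ^ 2 * Real.exp (-lam * u) := by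
  rw [deriv_saddleFun_eq_mul hlam]
  exact mul_pos (Real.exp_pos _) (sub_pos.2 (by gcongr))

theorem deriv_saddleFun_neg {lam u : ℝ} (hlam : 0 < lam) (hu : u < saddleTurningPoint lam) :
    Real.exp u - lam ^ 2 * Real.exp (-lam * u) < 0 := by
  rw [deriv_saddleFun_eq_mul hlam]
  exact mul_neg_of_pos_of_neg (Real.exp_pos _) (sub_neg.2 (by gcongr))

theorem strictMonoOn_saddleFun {lam : ℝ} (hlam : 0 < lam) :
    StrictMonoOn (saddleFun lam) (Ici (saddleTurningPoint lam)) := by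
  refine strictMonoOn_of_deriv_pos (convex_Ici _) (continuous_saddleFun lam).continuousOn
    fun u hu => ?_
  rw [(hasDerivAt_saddleFun lam u).deriv]
  exact deriv_saddleFun_pos hlam (by simpa using hu)

theorem strictAntiOn_saddleFun {lam : ℝ} (hlam : 0 < lam) :
    StrictAntiOn (saddleFun lam) (Iic (saddleTurningPoint lam)) := by
  refine strictAntiOn_of_deriv_neg (convex_Iic _) (continuous_saddleFun lam).continuousOn
    fun u hu => ?_
  rw [(hasDerivAt_saddleFun lam u).deriv]
  exact deriv_saddleFun_neg hlam (by simpa using hu)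

theorem exists_realSaddles_eq_pair {lam a : ℝ} (hlam : 0 < lam)
    (ha : (1 / 2 : ℝ) * (1 + lam) * lam ^ ((1 - lam) / (1 + lam)) < a) :
    ∃ u1 u0, u1 < saddleTurningPoint lam ∧ saddleTurningPoint lam < u0 ∧
      realSaddles lam a = {u1, u0} :=
  exists_setOf_eq_eq_pair (continuous_saddleFun lam) (strictAntiOn_saddleFun hlam)
    (strictMonoOn_saddleFun hlam) (tendsto_saddleFun_atBot hlam)
    (tendsto_saddleFun_atTop (by linarith))
    ((saddleFun_turningPoint hlam).trans_lt (by linarith))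

theorem iteratedDeriv_phase (lam a : ℝ) (n : ℕ) :
    iteratedDeriv (n + 2) (phase lam a) = fun u =>
      (Real.exp u - (-lam) ^ (n + 2) * Real.exp (-lam * u)) / 2 := by
  have hexp : ∀ u, HasDerivAt (fun u => Real.exp (-lam * u)) (-lam * Real.exp (-lam * u)) u :=
    fun u => (((hasDerivAt_id u).const_mul (-lam)).exp).congr_deriv (by simp only [id]; ring)
  induction n with
  | zero =>
    have hderiv : deriv (phase lam a) =
        fun u => (Real.exp u - (-lam) * Real.exp (-lam * u)) / 2 - a := by
      ext u
      exact ((((Real.hasDerivAt_exp u).sub (hexp u)).div_const 2).sub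
        (((hasDerivAt_id u).const_mul a))).deriv.trans (by ring)
    rw [zero_add, iteratedDeriv_succ, iteratedDeriv_one, hderiv]
    ext u
    exact ((((Real.hasDerivAt_exp u).sub ((hexp u).const_mul (-lam))).div_const 2).sub_const
      a).deriv.trans (by ring)
  | succ n ih =>
    rw [iteratedDeriv_succ, ih]
    ext u
    exact (((Real.hasDerivAt_exp u).sub ((hexp u).const_mul _)).div_const 2).deriv.trans (by ring)

theorem hasDerivAt_cexp_const_mul (k u : ℂ) :
    HasDerivAt (fun u => Complex.exp (k * u)) (k * Complex.exp (k * u)) u :=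
  (((hasDerivAt_id u).const_mul k).cexp).congr_deriv (by simp only [id]; ring)

theorem hasDerivAt_phaseC (lam a : ℝ) (u : ℂ) : HasDerivAt (phaseC lam a)
    ((Complex.exp u + lam * Complex.exp (-(lam : ℂ) * u)) / 2 - a) u :=
  ((((Complex.hasDerivAt_exp u).sub (hasDerivAt_cexp_const_mul (-lam) u)).div_const 2).sub
    (((hasDerivAt_id u).const_mul (a : ℂ)))).congr_deriv (by ring)

theorem iteratedDeriv_phaseC (lam a : ℝ) (n : ℕ) :
    iteratedDeriv (n + 2) (phaseC lam a) = fun u =>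
      (Complex.exp u - (-(lam : ℂ)) ^ (n + 2) * Complex.exp (-(lam : ℂ) * u)) / 2 := by
  induction n with
  | zero =>
    rw [zero_add, iteratedDeriv_succ, iteratedDeriv_one,
      funext fun u => (hasDerivAt_phaseC lam a u).deriv]
    ext u
    exact ((((Complex.hasDerivAt_exp u).add ((hasDerivAt_cexp_const_mul (-lam) u).const_mul
      (lam : ℂ))).div_const 2).sub_const (a : ℂ)).deriv.trans (by ring)
  | succ n ih =>
    rw [iteratedDeriv_succ, ih]
    ext u
    exact (((Complex.hasDerivAt_exp u).sub ((hasDerivAt_cexp_const_mul (-lam) u).const_mul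
      _)).div_const 2).deriv.trans (by ring)

theorem iteratedDeriv_phaseC_ofReal (lam a u0 : ℝ) {n : ℕ} (hn : 2 ≤ n) :
    iteratedDeriv n (phaseC lam a) u0 = (phaseDeriv lam a u0 n : ℂ) := by
  obtain ⟨k, rfl⟩ := Nat.exists_eq_add_of_le' hn
  rw [phaseDeriv, iteratedDeriv_phase, iteratedDeriv_phaseC]
  push_cast
  rfl

theorem phaseDeriv_two (lam a u0 : ℝ) :
    phaseDeriv lam a u0 2 = (Real.exp u0 - lam ^ 2 * Real.exp (-lam * u0)) / 2 := by
  rw [phaseDeriv, iteratedDeriv_phase lam a 0, zero_add, neg_sq]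

theorem phaseDeriv_eq {lam a u0 : ℝ} (hu0 : u0 ∈ realSaddles lam a) {n : ℕ} (hn : 2 ≤ n) :
    phaseDeriv lam a u0 n =
      (1 - (-lam) ^ (n - 1)) * Real.exp u0 / 2 + a * (-lam) ^ (n - 1) := by
  obtain ⟨k, rfl⟩ := Nat.exists_eq_add_of_le' hn
  have hsaddle : Real.exp u0 + lam * Real.exp (-lam * u0) = 2 * a := hu0
  rw [phaseDeriv, iteratedDeriv_phase, show k + 2 - 1 = k + 1 from rfl]
  linear_combination (-lam) ^ (k + 1) / 2 * hsaddle

theorem phaseDeriv_two_pos_of_neg {lam a u0 : ℝ} (ha : 0 < a) (hlam : -1 < lam) (hlam0 : lam < 0)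
    (hu0 : u0 ∈ realSaddles lam a) : 0 < phaseDeriv lam a u0 2 := by
  have hsaddle : Real.exp u0 + lam * Real.exp (-lam * u0) = 2 * a := hu0
  have hsq : lam ^ 2 * Real.exp (-lam * u0) < -lam * Real.exp (-lam * u0) :=
    mul_lt_mul_of_pos_right (by nlinarith) (Real.exp_pos _)
  rw [phaseDeriv_two]
  linarith

theorem exists_isGreatest_realSaddles {lam a : ℝ} (ha : 0 < a)
    (hlam : (-1 < lam ∧ lam < 0) ∨
      (0 < lam ∧ (1 / 2 : ℝ) * (1 + lam) * lam ^ ((1 - lam) / (1 + lam)) < a)) :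
    ∃ u0, IsGreatest (realSaddles lam a) u0 ∧ (lam < 0 → realSaddles lam a = {u0}) ∧
      (0 < lam → (realSaddles lam a).ncard = 2) ∧ 0 < phaseDeriv lam a u0 2 := by
  rcases hlam with ⟨hlam, hlam0⟩ | ⟨hlam0, hbound⟩
  · obtain ⟨u0, hu0⟩ := exists_realSaddles_eq_singleton ha hlam hlam0
    exact ⟨u0, hu0 ▸ isGreatest_singleton, fun _ => hu0, fun h => absurd h hlam0.not_gt,
      phaseDeriv_two_pos_of_neg ha hlam hlam0 (by rw [hu0]; rfl)⟩
  · obtain ⟨u1, u0, hu1, hu0, hpair⟩ := exists_realSaddles_eq_pair hlam0 hbound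
    have hlt := hu1.trans hu0
    refine ⟨u0, ?_, fun h => absurd h hlam0.not_gt, fun _ => hpair ▸ Set.ncard_pair hlt.ne, ?_⟩
    · rw [hpair]
      simpa [hlt.le] using isGreatest_pair (a := u1) (b := u0)
    · rw [phaseDeriv_two]
      exact half_pos (deriv_saddleFun_pos hlam0 hu0)

/-! ### Power series reversion at the saddle point -/

/-- The Taylor series at `0` of an analytic function. -/
def taylorSeries (f : ℂ → ℂ) : PowerSeries ℂ :=
  PowerSeries.mk fun k => iteratedDeriv k f 0 / k.factorial

section TaylorSeries

variable {f g : ℂ → ℂ}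

@[simp]
theorem coeff_taylorSeries (f : ℂ → ℂ) (k : ℕ) :
    (taylorSeries f).coeff k = iteratedDeriv k f 0 / k.factorial :=
  PowerSeries.coeff_mk _ _

theorem taylorSeries_congr (h : f =ᶠ[𝓝 0] g) : taylorSeries f = taylorSeries g := by
  ext k
  rw [coeff_taylorSeries, coeff_taylorSeries, h.iteratedDeriv_eq k]

theorem taylorSeries_const (c : ℂ) : taylorSeries (fun _ => c) = PowerSeries.C c := by
  ext k
  cases k <;> simp [iteratedDeriv_const, PowerSeries.coeff_C]

theorem taylorSeries_id : taylorSeries (fun r => r) = PowerSeries.X := by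
  ext k
  by_cases hk : k = 1 <;> simp [iteratedDeriv_fun_id_zero, PowerSeries.coeff_X, hk]

theorem taylorSeries_add (hf : AnalyticAt ℂ f 0) (hg : AnalyticAt ℂ g 0) :
    taylorSeries (fun r => f r + g r) = taylorSeries f + taylorSeries g := by
  ext k
  simp only [map_add, coeff_taylorSeries, iteratedDeriv_fun_add hf.contDiffAt hg.contDiffAt,
    add_div]

theorem taylorSeries_mul (hf : AnalyticAt ℂ f 0) (hg : AnalyticAt ℂ g 0) :
    taylorSeries (fun r => f r * g r) = taylorSeries f * taylorSeries g := by
  ext k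
  simp only [PowerSeries.coeff_mul, coeff_taylorSeries,
    Finset.Nat.sum_antidiagonal_eq_sum_range_succ_mk,
    iteratedDeriv_fun_mul hf.contDiffAt hg.contDiffAt, Finset.sum_div]
  refine Finset.sum_congr rfl fun i hi => ?_
  rw [Nat.cast_choose ℂ (Finset.mem_range_succ_iff.1 hi)]
  field_simp [Nat.factorial_ne_zero]

theorem taylorSeries_pow (hf : AnalyticAt ℂ f 0) (n : ℕ) :
    taylorSeries (fun r => f r ^ n) = taylorSeries f ^ n := by
  induction n with
  | zero => simpa using taylorSeries_const 1
  | succ n ih => simp only [pow_succ, taylorSeries_mul (hf.fun_pow n) hf, ih]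

theorem taylorSeries_sum {ι : Type*} {s : Finset ι} {f : ι → ℂ → ℂ}
    (hf : ∀ i ∈ s, AnalyticAt ℂ (f i) 0) :
    taylorSeries (fun r => ∑ i ∈ s, f i r) = ∑ i ∈ s, taylorSeries (f i) := by
  ext k
  simp only [map_sum, coeff_taylorSeries,
    iteratedDeriv_fun_sum fun i hi => (hf i hi).contDiffAt, Finset.sum_div]

theorem X_pow_dvd_taylorSeries_comp_sub (hf : AnalyticAt ℂ f 0) (hg : AnalyticAt ℂ g 0)
    (hg0 : g 0 = 0) (n : ℕ) :
    PowerSeries.X ^ n ∣ taylorSeries (fun r => f (g r)) -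
      ∑ k ∈ Finset.range n, PowerSeries.C ((taylorSeries f).coeff k) * taylorSeries g ^ k := by
  obtain ⟨remainder, hrem, hf_eq⟩ := hf.exists_eq_sum_add_pow_mul n
  have hrem_g : AnalyticAt ℂ (fun r => remainder (g r)) 0 :=
    AnalyticAt.fun_comp (by rwa [hg0]) hg
  have hterm (c : ℂ) (k : ℕ) : taylorSeries (fun r => c * g r ^ k) =
      PowerSeries.C c * taylorSeries g ^ k := by
    rw [taylorSeries_mul analyticAt_const (hg.fun_pow k), taylorSeries_const, taylorSeries_pow hg]
  have hfg : (fun r => f (g r)) = fun r =>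
      (∑ k ∈ Finset.range n, (taylorSeries f).coeff k * g r ^ k) + g r ^ n * remainder (g r) := by
    funext r
    rw [hf_eq (g r)]
    simp only [coeff_taylorSeries, smul_eq_mul, add_left_inj]
    exact Finset.sum_congr rfl fun k _ => by ring
  have hX : PowerSeries.X ∣ taylorSeries g := by
    rw [PowerSeries.X_dvd_iff, ← PowerSeries.coeff_zero_eq_constantCoeff_apply]
    simp [hg0]
  rw [hfg, taylorSeries_add (Finset.analyticAt_fun_sum _ fun k _ => by fun_prop)
      ((hg.fun_pow n).fun_mul hrem_g),
    taylorSeries_sum fun k _ => by fun_prop, taylorSeries_mul (hg.fun_pow n) hrem_g,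
    taylorSeries_pow hg, Finset.sum_congr rfl fun k _ => hterm _ k, add_sub_cancel_left]
  exact (pow_dvd_pow_of_dvd hX n).mul_right _

end TaylorSeries

theorem coeff_mul_eq_sum_range {R : Type*} [Semiring R] (F G : PowerSeries R) (n : ℕ) :
    (F * G).coeff n = ∑ k ∈ Finset.range (n + 1), F.coeff k * G.coeff (n - k) := by
  rw [PowerSeries.coeff_mul, Finset.Nat.sum_antidiagonal_eq_sum_range_succ_mk]

open PowerSeries in
/-- The coefficient of `X ^ (j + 2)` is affine in the coefficient of `X ^ j` of `T` and otherwise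
involves only lower coefficients of `T`, so these are found one after the other. -/
theorem coeff_reversion_of_X_pow_dvd {K : Type*} [Field K] [CharZero K] {h : ℕ → K}
    {T : PowerSeries K} (h2 : h 2 = 1) (hT0 : T.coeff 0 = 1)
    (hT : X ^ 9 ∣ X ^ 2 - ∑ k ∈ Finset.Ico 2 9, C (2 * h k / k.factorial) * (X * T) ^ k) :
    T.coeff 2 = (5 * h 3 ^ 2 - 3 * h 4) / 72 ∧
    T.coeff 4 = (385 * h 3 ^ 4 - 630 * h 3 ^ 2 * h 4 + 105 * h 4 ^ 2 + 168 * h 3 * h 5 - 24 * h 6) /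
      17280 ∧
    T.coeff 6 = (425425 * h 3 ^ 6 - 1126125 * h 3 ^ 4 * h 4 + 675675 * h 3 ^ 2 * h 4 ^ 2
      - 51975 * h 4 ^ 3 + 360360 * h 3 ^ 3 * h 5 - 249480 * h 3 * h 4 * h 5 + 13608 * h 5 ^ 2
      - 83160 * h 3 ^ 2 * h 6 + 22680 * h 4 * h 6 + 12960 * h 3 * h 7 - 1080 * h 8) / 43545600 := by
  have heq (j : ℕ) (hj : j < 9) := PowerSeries.X_pow_dvd_iff.1 hT j hj
  simp only [map_sub, map_sum, mul_pow, coeff_C_mul, coeff_X_pow_mul', coeff_X_pow] at heq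
  have hpow : T ^ 2 = T * T ∧ T ^ 3 = T ^ 2 * T ∧ T ^ 4 = T ^ 2 * T ^ 2 ∧ T ^ 5 = T ^ 4 * T ∧
      T ^ 6 = T ^ 4 * T ^ 2 ∧ T ^ 7 = T ^ 6 * T ∧ T ^ 8 = T ^ 4 * T ^ 4 :=
    ⟨by ring, by ring, by ring, by ring, by ring, by ring, by ring⟩
  obtain ⟨hpow2, hpow3, hpow4, hpow5, hpow6, hpow7, hpow8⟩ := hpow
  have heq1 := heq 3 (by norm_num)
  have heq2 := heq 4 (by norm_num)
  have heq3 := heq 5 (by norm_num)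
  have heq4 := heq 6 (by norm_num)
  have heq5 := heq 7 (by norm_num)
  have heq6 := heq 8 (by norm_num)
  norm_num only [Finset.sum_Ico_eq_sum_range, Finset.sum_range_succ, Finset.sum_range_zero, h2,
    Nat.factorial, if_true, if_false] at heq1 heq2 heq3 heq4 heq5 heq6
  simp only [hpow8, hpow7, hpow6, hpow5, hpow4, hpow3, hpow2, coeff_mul_eq_sum_range,
    Finset.sum_range_succ, Finset.sum_range_zero, Nat.reduceAdd, Nat.reduceSub, Nat.sub_zero,
    Nat.sub_self, zero_add, hT0, one_mul, mul_one] at heq1 heq2 heq3 heq4 heq5 heq6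
  have coeff1 : T.coeff 1 = -h 3 / 6 := by linear_combination -heq1 / 2
  rw [coeff1] at heq2 heq3 heq4 heq5 heq6
  have coeff2 : T.coeff 2 = (5 * h 3 ^ 2 - 3 * h 4) / 72 := by linear_combination -heq2 / 2
  rw [coeff2] at heq3 heq4 heq5 heq6
  have coeff3 : T.coeff 3 = (-40 * h 3 ^ 3 + 45 * h 3 * h 4 - 9 * h 5) / 1080 := by
    linear_combination -heq3 / 2
  rw [coeff3] at heq4 heq5 heq6
  have coeff4 : T.coeff 4 = (385 * h 3 ^ 4 - 630 * h 3 ^ 2 * h 4 + 105 * h 4 ^ 2 + 168 * h 3 * h 5 -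
      24 * h 6) / 17280 := by linear_combination -heq4 / 2
  rw [coeff4] at heq5 heq6
  have coeff5 : T.coeff 5 = (-1960 * h 3 ^ 5 + 4200 * h 3 ^ 3 * h 4 - 1260 * h 3 ^ 2 * h 5 -
      1575 * h 3 * h 4 ^ 2 + 252 * h 3 * h 6 + 378 * h 4 * h 5 - 27 * h 7) / 136080 := by
    linear_combination -heq5 / 2
  rw [coeff5] at heq6
  exact ⟨coeff2, coeff4, by linear_combination -heq6 / 2⟩

section SquareRoot

variable {Φ Ψ S : ℂ → ℂ}

theorem exists_eq_sq_mul (hΦ : AnalyticAt ℂ Φ 0) (h0 : Φ 0 = 0) (h1 : iteratedDeriv 1 Φ 0 = 0)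
    (h2 : iteratedDeriv 2 Φ 0 = 2) :
    ∃ q : ℂ → ℂ, AnalyticAt ℂ q 0 ∧ q 0 = 1 ∧ ∀ s, Φ s = s ^ 2 * q s := by
  obtain ⟨remainder, hrem, hΦ_eq⟩ := hΦ.exists_eq_sum_add_pow_mul 3
  refine ⟨fun s => 1 + s * remainder s, by fun_prop, by simp, fun s => ?_⟩
  rw [hΦ_eq]
  simp only [Finset.sum_range_succ, Finset.sum_range_zero, iteratedDeriv_zero, h0, h1, h2,
    smul_eq_mul, Nat.factorial_two]
  push_cast
  ring

theorem exists_analyticAt_sqrt (hΦ : AnalyticAt ℂ Φ 0) (h0 : Φ 0 = 0)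
    (h1 : iteratedDeriv 1 Φ 0 = 0) (h2 : iteratedDeriv 2 Φ 0 = 2)
    (hconj : ∀ s, Φ (conj s) = conj (Φ s)) :
    ∃ Ψ : ℂ → ℂ, AnalyticAt ℂ Ψ 0 ∧ Ψ 0 = 0 ∧ deriv Ψ 0 = 1 ∧ (∀ s, Ψ s ^ 2 = Φ s) ∧
      ∀ᶠ s in 𝓝 0, Ψ (conj s) = conj (Ψ s) := by
  obtain ⟨q, hq, hq0, hΦq⟩ := exists_eq_sq_mul hΦ h0 h1 h2
  have hq_slit : ∀ᶠ s in 𝓝 0, q s ∈ slitPlane :=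
    hq.continuousAt.eventually_mem (Complex.isOpen_slitPlane.mem_nhds (by simp [hq0]))
  have hq_conj (s : ℂ) : q (conj s) = conj (q s) := by
    rcases eq_or_ne s 0 with rfl | hs
    · simp [hq0]
    · have hsq : (conj s) ^ 2 * q (conj s) = (conj s) ^ 2 * conj (q s) := by
        rw [← hΦq, hconj, hΦq, map_mul, map_pow]
      exact mul_left_cancel₀ (pow_ne_zero 2 (by simpa using hs)) hsq
  have hroot : AnalyticAt ℂ (fun s => q s ^ ((1 / 2 : ℝ) : ℂ)) 0 :=
    hq.cpow analyticAt_const (by simp [hq0])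
  refine ⟨fun s => s * q s ^ ((1 / 2 : ℝ) : ℂ), analyticAt_id.mul hroot, zero_mul _, ?_,
    fun s => ?_, ?_⟩
  · have hderiv := ((hasDerivAt_id (0 : ℂ)).mul hroot.differentiableAt.hasDerivAt).deriv
    simpa only [id, zero_mul, add_zero, one_mul, hq0, Complex.one_cpow] using! hderiv
  · rw [hΦq, mul_pow, ← Complex.cpow_nat_mul]
    norm_num
  · filter_upwards [hq_slit] with s hs
    rw [hq_conj, map_mul, Complex.conj_cpow _ _ (Complex.slitPlane_arg_ne_pi hs),
      Complex.conj_ofReal]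

theorem exists_analyticAt_localInverse (hΨ : AnalyticAt ℂ Ψ 0) (hΨ0 : Ψ 0 = 0)
    (hderiv : deriv Ψ 0 = 1) :
    ∃ S : ℂ → ℂ, AnalyticAt ℂ S 0 ∧ S 0 = 0 ∧ deriv S 0 = 1 ∧ (∀ᶠ s in 𝓝 0, S (Ψ s) = s) ∧
      ∀ᶠ r in 𝓝 0, Ψ (S r) = r := by
  have hne : deriv Ψ 0 ≠ 0 := by simp [hderiv]
  have hS := hΨ.analyticAt_localInverse hne
  have hleft := hΨ.hasStrictDerivAt.eventually_left_inverse hne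
  have hright := hΨ.hasStrictDerivAt.eventually_right_inverse hne
  have hS_deriv := (hΨ.hasStrictDerivAt.to_localInverse hne).hasDerivAt.deriv
  rw [hΨ0] at hS hright hS_deriv
  exact ⟨_, hS, by simpa [hΨ0] using hleft.self_of_nhds, by simpa [hderiv] using hS_deriv, hleft,
    hright⟩

theorem eventually_conj_of_localInverse (hS : AnalyticAt ℂ S 0) (hS0 : S 0 = 0)
    (hΨ_conj : ∀ᶠ s in 𝓝 0, Ψ (conj s) = conj (Ψ s)) (hleft : ∀ᶠ s in 𝓝 0, S (Ψ s) = s)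
    (hright : ∀ᶠ r in 𝓝 0, Ψ (S r) = r) : ∀ᶠ r in 𝓝 0, S (conj r) = conj (S r) := by
  have hconj : Tendsto (fun s : ℂ => conj s) (𝓝 0) (𝓝 0) := by
    simpa using Complex.continuous_conj.tendsto (0 : ℂ)
  have hS_tendsto : Tendsto S (𝓝 0) (𝓝 0) := by simpa [hS0] using hS.continuousAt.tendsto
  filter_upwards [hright, hS_tendsto.eventually hΨ_conj,
    hS_tendsto.eventually (hconj.eventually hleft)] with r hΨS hΨ_conj_r hSΨ
  rw [← hSΨ, hΨ_conj_r, hΨS]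

theorem conj_iteratedDeriv_of_eventually_conj (h : ∀ᶠ r in 𝓝 0, S (conj r) = conj (S r)) (n : ℕ) :
    conj (iteratedDeriv n S 0) = iteratedDeriv n S 0 := by
  suffices ∀ᶠ r in 𝓝 0, iteratedDeriv n S (conj r) = conj (iteratedDeriv n S r) by
    simpa using this.self_of_nhds.symm
  induction n with
  | zero => simpa using h
  | succ n ih =>
    have hreflect : iteratedDeriv n S =ᶠ[𝓝 0] conj ∘ iteratedDeriv n S ∘ conj := by
      filter_upwards [ih] with r hr
      simp [hr]
    filter_upwards [hreflect.deriv] with r hr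
    rw [iteratedDeriv_succ, hr, deriv_conj_conj]
    simp

end SquareRoot

/-- The normalized phase `2 (h(u₀ + s) - h(u₀)) / h₀''`, which is `s² + O(s³)` if `u₀` is a saddle
point. -/
def normalizedPhase (lam a u0 : ℝ) (s : ℂ) : ℂ :=
  2 / (phaseDeriv lam a u0 2 : ℂ) * (phaseC lam a (u0 + s) - phaseC lam a u0)

/-- `Ψ` is an analytic square root of the normalized phase at the saddle point and `S` its local
inverse, with real Taylor coefficients. The reversion of the theorem is
`u(w) = u₀ + S(w / √(-h₀''))`. -/
structure IsSaddleReversion (lam a u0 : ℝ) (Ψ S : ℂ → ℂ) : Prop where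
  analyticAt_sqrt : AnalyticAt ℂ Ψ 0
  analyticAt : AnalyticAt ℂ S 0
  sqrt_zero : Ψ 0 = 0
  zero : S 0 = 0
  deriv_sqrt : deriv Ψ 0 = 1
  deriv_zero : deriv S 0 = 1
  sqrt_sq : ∀ s, Ψ s ^ 2 = normalizedPhase lam a u0 s
  left_inv : ∀ᶠ s in 𝓝 0, S (Ψ s) = s
  right_inv : ∀ᶠ r in 𝓝 0, Ψ (S r) = r
  conj_iteratedDeriv : ∀ n, conj (iteratedDeriv n S 0) = iteratedDeriv n S 0

section NormalizedPhase

variable {lam a u0 : ℝ}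

theorem analyticAt_normalizedPhase (s : ℂ) : AnalyticAt ℂ (normalizedPhase lam a u0) s := by
  unfold normalizedPhase phaseC
  fun_prop

theorem normalizedPhase_zero : normalizedPhase lam a u0 0 = 0 := by simp [normalizedPhase]

theorem half_phaseDeriv_mul_normalizedPhase (h2pos : 0 < phaseDeriv lam a u0 2) (s : ℂ) :
    (phaseDeriv lam a u0 2 : ℂ) / 2 * normalizedPhase lam a u0 s =
      phaseC lam a (u0 + s) - phaseC lam a u0 := by
  have h2ne : (phaseDeriv lam a u0 2 : ℂ) ≠ 0 := by exact_mod_cast h2pos.ne'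
  rw [normalizedPhase]
  field_simp

theorem deriv_phaseC_saddle (hu0 : u0 ∈ realSaddles lam a) : deriv (phaseC lam a) u0 = 0 := by
  have hsaddle : Real.exp u0 + lam * Real.exp (-lam * u0) = 2 * a := hu0
  have hsaddleC : Complex.exp u0 + lam * Complex.exp (-(lam : ℂ) * u0) = 2 * a :=
    mod_cast congrArg Complex.ofReal hsaddle
  rw [(hasDerivAt_phaseC lam a u0).deriv, hsaddleC]
  ring

theorem iteratedDeriv_normalizedPhase {n : ℕ} (hn : n ≠ 0) (s : ℂ) :
    iteratedDeriv n (normalizedPhase lam a u0) s =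
      2 / (phaseDeriv lam a u0 2 : ℂ) * iteratedDeriv n (phaseC lam a) (u0 + s) := by
  obtain ⟨k, rfl⟩ := Nat.exists_eq_succ_of_ne_zero hn
  have hderiv : deriv (normalizedPhase lam a u0) =
      fun s => 2 / (phaseDeriv lam a u0 2 : ℂ) * deriv (phaseC lam a) (u0 + s) := by
    ext s
    unfold normalizedPhase
    rw [deriv_const_mul_field, deriv_sub_const, deriv_comp_const_add]
  rw [Nat.succ_eq_add_one, iteratedDeriv_succ', hderiv, iteratedDeriv_const_mul_field,
    iteratedDeriv_comp_const_add, iteratedDeriv_succ']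

theorem iteratedDeriv_one_normalizedPhase_zero (hu0 : u0 ∈ realSaddles lam a) :
    iteratedDeriv 1 (normalizedPhase lam a u0) 0 = 0 := by
  rw [iteratedDeriv_normalizedPhase one_ne_zero, iteratedDeriv_one, add_zero,
    deriv_phaseC_saddle hu0, mul_zero]

theorem iteratedDeriv_normalizedPhase_zero {n : ℕ} (hn : 2 ≤ n) :
    iteratedDeriv n (normalizedPhase lam a u0) 0 = 2 * (phaseRatio lam a u0 n : ℂ) := by
  rw [iteratedDeriv_normalizedPhase (by omega), add_zero, iteratedDeriv_phaseC_ofReal _ _ _ hn,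
    phaseRatio]
  push_cast
  ring

theorem phaseRatio_two (h2pos : 0 < phaseDeriv lam a u0 2) : phaseRatio lam a u0 2 = 1 :=
  div_self h2pos.ne'

theorem phaseC_conj (u : ℂ) : phaseC lam a (conj u) = conj (phaseC lam a u) := by
  simp [phaseC, ← Complex.exp_conj, map_ofNat]

theorem normalizedPhase_conj (s : ℂ) :
    normalizedPhase lam a u0 (conj s) = conj (normalizedPhase lam a u0 s) := by
  simp only [normalizedPhase, map_mul, map_div₀, map_sub, map_ofNat, ← phaseC_conj, map_add,
    Complex.conj_ofReal]

theorem exists_isSaddleReversion (hu0 : u0 ∈ realSaddles lam a)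
    (h2pos : 0 < phaseDeriv lam a u0 2) : ∃ Ψ S, IsSaddleReversion lam a u0 Ψ S := by
  obtain ⟨Ψ, hΨ, hΨ0, hΨ_deriv, hΨ_sq, hΨ_conj⟩ :=
    exists_analyticAt_sqrt (analyticAt_normalizedPhase (lam := lam) (a := a) (u0 := u0) 0)
      normalizedPhase_zero (iteratedDeriv_one_normalizedPhase_zero hu0)
      (by simp [iteratedDeriv_normalizedPhase_zero le_rfl, phaseRatio_two h2pos])
      normalizedPhase_conj
  obtain ⟨S, hS, hS0, hS_deriv, hleft, hright⟩ := exists_analyticAt_localInverse hΨ hΨ0 hΨ_deriv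
  exact ⟨Ψ, S, hΨ, hS, hΨ0, hS0, hΨ_deriv, hS_deriv, hΨ_sq, hleft, hright,
    conj_iteratedDeriv_of_eventually_conj
      (eventually_conj_of_localInverse hS hS0 hΨ_conj hleft hright)⟩

end NormalizedPhase

/-- The coefficient `A_k` of the even part of the derivative of the reversion. -/
def reversionCoeff (lam a u0 : ℝ) (S : ℂ → ℂ) (k : ℕ) : ℝ :=
  (iteratedDeriv (2 * k + 1) S 0).re / ((2 * k).factorial * phaseDeriv lam a u0 2 ^ k)

theorem invSqrtNeg_sq {lam a u0 : ℝ} (h2pos : 0 < phaseDeriv lam a u0 2) :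
    invSqrtNeg lam a u0 ^ 2 = -1 / (phaseDeriv lam a u0 2 : ℂ) := by
  rw [invSqrtNeg, div_pow, Complex.I_sq, ← Complex.ofReal_pow, Real.sq_sqrt h2pos.le]

theorem hasSum_even_part_deriv {S : ℂ → ℂ} (hS : AnalyticAt ℂ S 0) :
    ∀ᶠ r in 𝓝 0, HasSum
      (fun k : ℕ => iteratedDeriv (2 * k + 1) S 0 / (2 * k).factorial * r ^ (2 * k))
      ((deriv S r + deriv S (-r)) / 2) := by
  have hneg : Tendsto (fun r : ℂ => -r) (𝓝 0) (𝓝 0) := by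
    simpa using continuous_neg.tendsto (0 : ℂ)
  have hsum := hS.deriv.hasFPowerSeriesAt.eventually_hasSum
  filter_upwards [hsum, hneg.eventually hsum] with r hr hr_neg
  simp only [FormalMultilinearSeries.ofScalars_apply_eq, smul_eq_mul, zero_add] at hr hr_neg
  have hodd_zero : ∀ n ∉ Set.range (fun k : ℕ => 2 * k),
      (iteratedDeriv n (deriv S) 0 / n.factorial * r ^ n +
        iteratedDeriv n (deriv S) 0 / n.factorial * (-r) ^ n) / 2 = 0 := by
    intro n hn
    have hodd : Odd n := by
      rw [← Nat.not_even_iff_odd, even_iff_exists_two_mul]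
      exact fun ⟨k, hk⟩ => hn ⟨k, hk.symm⟩
    rw [hodd.neg_pow]
    ring
  have heven := ((mul_right_injective₀ (two_ne_zero' ℕ)).hasSum_iff hodd_zero).2
    ((hr.add hr_neg).div_const 2)
  refine heven.congr_fun fun k => ?_
  rw [Function.comp_apply, (even_two_mul k).neg_pow, ← iteratedDeriv_succ']
  ring

/-- The local reversion `u(w) = u₀ + S(w/√(-h₀''))` of the quadratic normal form `-w²/2`, where `S`
inverts the square root of the normalized phase. -/
def saddleReversion (lam a u0 : ℝ) (S : ℂ → ℂ) (w : ℂ) : ℂ :=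
  u0 + S (invSqrtNeg lam a u0 * w)

theorem deriv_saddleReversion (lam a u0 : ℝ) (S : ℂ → ℂ) (w : ℂ) :
    deriv (saddleReversion lam a u0 S) w =
      invSqrtNeg lam a u0 * deriv S (invSqrtNeg lam a u0 * w) := by
  unfold saddleReversion
  rw [deriv_const_add, deriv_comp_mul_left, smul_eq_mul]

theorem tendsto_const_mul_zero (c : ℂ) : Tendsto (fun w => c * w) (𝓝 0) (𝓝 0) := by
  simpa using (continuous_const_mul c).tendsto (0 : ℂ)

namespace IsSaddleReversion

variable {lam a u0 : ℝ} {Ψ S : ℂ → ℂ}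

theorem iteratedDeriv_eq_re (hS : IsSaddleReversion lam a u0 Ψ S) (n : ℕ) :
    iteratedDeriv n S 0 = ((iteratedDeriv n S 0).re : ℂ) :=
  (Complex.conj_eq_iff_re.1 (hS.conj_iteratedDeriv n)).symm

theorem normalizedPhase_comp (hS : IsSaddleReversion lam a u0 Ψ S) :
    ∀ᶠ r in 𝓝 0, normalizedPhase lam a u0 (S r) = r ^ 2 := by
  filter_upwards [hS.right_inv] with r hr
  rw [← hS.sqrt_sq, hr]

theorem X_pow_dvd_taylorSeries (hS : IsSaddleReversion lam a u0 Ψ S) (n : ℕ) :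
    PowerSeries.X ^ n ∣ PowerSeries.X ^ 2 - ∑ k ∈ Finset.range n,
      PowerSeries.C ((taylorSeries (normalizedPhase lam a u0)).coeff k) * taylorSeries S ^ k := by
  have hcomp : taylorSeries (fun r => normalizedPhase lam a u0 (S r)) = PowerSeries.X ^ 2 := by
    rw [taylorSeries_congr hS.normalizedPhase_comp,
      taylorSeries_pow (f := fun r => r) analyticAt_id, taylorSeries_id]
  rw [← hcomp]
  exact X_pow_dvd_taylorSeries_comp_sub (analyticAt_normalizedPhase 0) hS.analyticAt hS.zero n

theorem exists_X_pow_dvd (hS : IsSaddleReversion lam a u0 Ψ S) (hu0 : u0 ∈ realSaddles lam a) :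
    ∃ T : PowerSeries ℂ, taylorSeries S = PowerSeries.X * T ∧
      PowerSeries.X ^ 9 ∣ PowerSeries.X ^ 2 - ∑ k ∈ Finset.Ico 2 9,
        PowerSeries.C (2 * (phaseRatio lam a u0 k : ℂ) / k.factorial) *
          (PowerSeries.X * T) ^ k := by
  obtain ⟨T, hT⟩ : PowerSeries.X ∣ taylorSeries S := by
    rw [PowerSeries.X_dvd_iff, ← PowerSeries.coeff_zero_eq_constantCoeff_apply]
    simp [hS.zero]
  refine ⟨T, hT, ?_⟩
  have hdvd := hS.X_pow_dvd_taylorSeries 9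
  rw [← Finset.sum_range_add_sum_Ico _ (show 2 ≤ 9 by norm_num), hT] at hdvd
  simp only [Finset.sum_range_succ, Finset.sum_range_zero, coeff_taylorSeries, iteratedDeriv_zero,
    normalizedPhase_zero, iteratedDeriv_one_normalizedPhase_zero hu0, zero_div, map_zero, zero_mul,
    add_zero, zero_add] at hdvd
  convert hdvd using 5 with k hk
  rw [iteratedDeriv_normalizedPhase_zero (Finset.mem_Ico.1 hk).1]

theorem taylor_coeffs (hS : IsSaddleReversion lam a u0 Ψ S) (hu0 : u0 ∈ realSaddles lam a)
    (h2pos : 0 < phaseDeriv lam a u0 2) {h : ℕ → ℂ} (hh : ∀ n, h n = phaseRatio lam a u0 n) :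
    iteratedDeriv 3 S 0 / 6 = (5 * h 3 ^ 2 - 3 * h 4) / 72 ∧
    iteratedDeriv 5 S 0 / 120 = (385 * h 3 ^ 4 - 630 * h 3 ^ 2 * h 4 + 105 * h 4 ^ 2 +
      168 * h 3 * h 5 - 24 * h 6) / 17280 ∧
    iteratedDeriv 7 S 0 / 5040 = (425425 * h 3 ^ 6 - 1126125 * h 3 ^ 4 * h 4 +
      675675 * h 3 ^ 2 * h 4 ^ 2 - 51975 * h 4 ^ 3 + 360360 * h 3 ^ 3 * h 5 -
      249480 * h 3 * h 4 * h 5 + 13608 * h 5 ^ 2 - 83160 * h 3 ^ 2 * h 6 + 22680 * h 4 * h 6 +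
      12960 * h 3 * h 7 - 1080 * h 8) / 43545600 := by
  obtain ⟨T, hT, hdvd⟩ := hS.exists_X_pow_dvd hu0
  simp only [← hh] at hdvd
  have hcoeff (k : ℕ) : T.coeff k = iteratedDeriv (k + 1) S 0 / (k + 1).factorial := by
    rw [← coeff_taylorSeries, hT, PowerSeries.coeff_succ_X_mul]
  have hT0 : T.coeff 0 = 1 := by simp [hcoeff, hS.deriv_zero]
  simpa [hcoeff, Nat.factorial] using
    coeff_reversion_of_X_pow_dvd (by rw [hh, phaseRatio_two h2pos, Complex.ofReal_one]) hT0 hdvd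

theorem isLocalReversion (hS : IsSaddleReversion lam a u0 Ψ S)
    (h2pos : 0 < phaseDeriv lam a u0 2) :
    IsLocalReversion lam a u0 (saddleReversion lam a u0 S) := by
  have h2ne : (phaseDeriv lam a u0 2 : ℂ) ≠ 0 := by exact_mod_cast h2pos.ne'
  refine ⟨?_, by simp [saddleReversion, hS.zero], ?_, ?_⟩
  · refine analyticAt_const.add (AnalyticAt.fun_comp ?_ (analyticAt_const.mul analyticAt_id))
    simpa using hS.analyticAt
  · rw [deriv_saddleReversion, mul_zero, hS.deriv_zero, mul_one]
  · filter_upwards [(tendsto_const_mul_zero _).eventually hS.normalizedPhase_comp] with w hw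
    rw [saddleReversion, ← half_phaseDeriv_mul_normalizedPhase h2pos, hw, mul_pow,
      invSqrtNeg_sq h2pos]
    field_simp

theorem hasSum_even_part_deriv_saddleReversion (hS : IsSaddleReversion lam a u0 Ψ S)
    (h2pos : 0 < phaseDeriv lam a u0 2) :
    ∀ᶠ w in 𝓝 (0 : ℂ), HasSum
      (fun k => invSqrtNeg lam a u0 * ((-1) ^ k * (reversionCoeff lam a u0 S k : ℂ) * w ^ (2 * k)))
      ((deriv (saddleReversion lam a u0 S) w + deriv (saddleReversion lam a u0 S) (-w)) / 2) := by
  have h2ne : (phaseDeriv lam a u0 2 : ℂ) ≠ 0 := by exact_mod_cast h2pos.ne'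
  filter_upwards [(tendsto_const_mul_zero (invSqrtNeg lam a u0)).eventually
    (hasSum_even_part_deriv hS.analyticAt)] with w hw
  rw [deriv_saddleReversion, deriv_saddleReversion, ← mul_add, mul_div_assoc, mul_neg]
  refine (hw.mul_left _).congr_fun fun k => ?_
  rw [mul_pow, pow_mul (invSqrtNeg lam a u0), invSqrtNeg_sq h2pos, hS.iteratedDeriv_eq_re,
    reversionCoeff, div_pow]
  push_cast
  field_simp

theorem isReversionCoeffs (hS : IsSaddleReversion lam a u0 Ψ S)
    (h2pos : 0 < phaseDeriv lam a u0 2) :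
    IsReversionCoeffs lam a u0 (reversionCoeff lam a u0 S) :=
  ⟨_, hS.isLocalReversion h2pos, hS.hasSum_even_part_deriv_saddleReversion h2pos⟩

theorem reversionCoeff_zero (hS : IsSaddleReversion lam a u0 Ψ S) :
    reversionCoeff lam a u0 S 0 = 1 := by
  simp [reversionCoeff, hS.deriv_zero]

theorem reversionCoeff_eq (hS : IsSaddleReversion lam a u0 Ψ S) (hu0 : u0 ∈ realSaddles lam a)
    {h2 : ℝ} {h : ℕ → ℝ} (hh2 : h2 = phaseDeriv lam a u0 2) (h2pos : 0 < h2)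
    (hh : ∀ n, h n = phaseRatio lam a u0 n) :
    reversionCoeff lam a u0 S 1 = (5 * h 3 ^ 2 - 3 * h 4) / (24 * h2) ∧
    reversionCoeff lam a u0 S 2 = (385 * h 3 ^ 4 - 630 * h 3 ^ 2 * h 4 + 105 * h 4 ^ 2 +
      168 * h 3 * h 5 - 24 * h 6) / (3456 * h2 ^ 2) ∧
    reversionCoeff lam a u0 S 3 = (425425 * h 3 ^ 6 - 1126125 * h 3 ^ 4 * h 4 +
      675675 * h 3 ^ 2 * h 4 ^ 2 - 51975 * h 4 ^ 3 + 360360 * h 3 ^ 3 * h 5 -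
      249480 * h 3 * h 4 * h 5 + 13608 * h 5 ^ 2 - 83160 * h 3 ^ 2 * h 6 + 22680 * h 4 * h 6 +
      12960 * h 3 * h 7 - 1080 * h 8) / (6220800 * h2 ^ 3) := by
  obtain ⟨taylor3, taylor5, taylor7⟩ := hS.taylor_coeffs hu0 (hh2 ▸ h2pos)
    (h := fun n => (h n : ℂ)) fun n => congrArg Complex.ofReal (hh n)
  rw [hS.iteratedDeriv_eq_re] at taylor3 taylor5 taylor7
  norm_cast at taylor3 taylor5 taylor7
  simp only [reversionCoeff, ← hh2, mul_one, Nat.reduceMul, Nat.reduceAdd, pow_one, Nat.factorial,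
    Nat.succ_eq_add_one, Nat.cast_ofNat, zero_add]
  refine ⟨?_, ?_, ?_⟩
  · rw [div_eq_div_iff (by positivity) (by positivity)]
    linear_combination 144 * h2 * taylor3
  · rw [div_eq_div_iff (by positivity) (by positivity)]
    linear_combination 24 * 120 * 144 * h2 ^ 2 * taylor5
  · rw [div_eq_div_iff (by positivity) (by positivity)]
    linear_combination 5040 * 6220800 * h2 ^ 3 * taylor7

end IsSaddleReversion

/-! ### Gaussian integrals along complex paths -/

theorem Gamma_nat_add_half (k : ℕ) :
    Real.Gamma (k + 1 / 2) = poch (1 / 2) k * Real.sqrt π := by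
  induction k with
  | zero => simpa [poch] using Real.Gamma_one_half_eq
  | succ k ih =>
    rw [Nat.cast_succ, add_right_comm, Real.Gamma_add_one (by positivity), ih, poch, poch,
      ascPochhammer_succ_eval]
    ring

/-- The `2k`-th moment of the unnormalized centred Gaussian weight of variance `1 / x`. -/
def gaussianMoment (x : ℝ) (k : ℕ) : ℝ :=
  ∫ w : ℝ, w ^ (2 * k) * Real.exp (-(x * w ^ 2 / 2))

theorem gaussianMoment_nonneg (x : ℝ) (k : ℕ) : 0 ≤ gaussianMoment x k :=
  integral_nonneg fun w => mul_nonneg ((even_two_mul k).pow_nonneg w) (Real.exp_pos _).le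

section GaussianMoment

variable {x : ℝ}

theorem integrable_pow_mul_gaussian (hx : 0 < x) (k : ℕ) :
    Integrable fun w : ℝ => w ^ (2 * k) * Real.exp (-(x * w ^ 2 / 2)) := by
  have hrpow := integrable_rpow_mul_exp_neg_mul_sq (half_pos hx) (s := (2 * k : ℕ))
    (neg_one_lt_zero.trans_le (Nat.cast_nonneg _))
  simpa only [Real.rpow_natCast, neg_mul, div_mul_eq_mul_div] using hrpow

theorem gaussianMoment_eq (hx : 0 < x) (k : ℕ) :
    gaussianMoment x k = Real.sqrt (2 * π / x) * (poch (1 / 2) k / (x / 2) ^ k) := by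
  have habs : gaussianMoment x k =
      2 * ∫ w in Ioi (0 : ℝ), w ^ (2 * k) * Real.exp (-(x * w ^ 2 / 2)) := by
    rw [gaussianMoment, ← integral_comp_abs]
    simp only [pow_mul, sq_abs]
  have hGamma := integral_rpow_mul_exp_neg_mul_rpow (p := 2) (q := (2 * k : ℕ)) (b := x / 2)
    two_pos (neg_one_lt_zero.trans_le (Nat.cast_nonneg _)) (half_pos hx)
  simp only [Real.rpow_natCast, Real.rpow_two, neg_mul, div_mul_eq_mul_div] at hGamma
  have hexponent : (((2 * k : ℕ) : ℝ) + 1) / 2 = k + 1 / 2 := by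
    push_cast
    ring
  have hpow : (x / 2) ^ (-(((2 * k : ℕ) : ℝ) + 1) / 2) =
      (Real.sqrt (x / 2))⁻¹ * ((x / 2) ^ k)⁻¹ := by
    rw [neg_div, hexponent, Real.rpow_neg (half_pos hx).le, Real.rpow_add (half_pos hx),
      Real.rpow_natCast, ← Real.sqrt_eq_rpow, mul_inv, mul_comm]
  have hsqrt : Real.sqrt (2 * π / x) = Real.sqrt π * (Real.sqrt (x / 2))⁻¹ := by
    rw [← Real.sqrt_inv, ← Real.sqrt_mul Real.pi_pos.le, inv_div]
    ring_nf
  rw [habs, hGamma, hpow, hexponent, Gamma_nat_add_half, hsqrt]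
  ring

theorem exp_neg_isBigO_gaussianMoment {κ : ℝ} (hκ : 0 < κ) (N : ℕ) :
    (fun x : ℝ => Real.exp (-κ * x)) =O[atTop] fun x => gaussianMoment x N := by
  refine (isLittleO_exp_neg_mul_rpow_atTop hκ (-(N + 1 / 2))).isBigO.trans ?_
  have hpoch : 0 < poch (1 / 2) N := ascPochhammer_pos N _ (by norm_num)
  refine (IsBigO.of_bound' ?_).trans
    ((isBigO_refl (fun x => gaussianMoment x N) atTop).const_mul_left
      ((Real.sqrt (2 * π))⁻¹ * (poch (1 / 2) N * 2 ^ N)⁻¹))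
  filter_upwards [eventually_gt_atTop 0] with x hx
  rw [gaussianMoment_eq hx, Real.rpow_neg hx.le, Real.rpow_add hx, Real.rpow_natCast,
    ← Real.sqrt_eq_rpow, Real.sqrt_div (by positivity), div_pow]
  refine le_of_eq (congrArg norm ?_)
  field_simp

theorem norm_integral_gaussian_mul_sub_le {F : ℝ → ℂ} {e : ℕ → ℂ} {C : ℝ} {N : ℕ} (hx : 0 < x)
    (hF : Integrable fun w : ℝ => Complex.exp (-(x * w ^ 2 / 2)) * F w)
    (hbound : ∀ w : ℝ, ‖F w - ∑ k ∈ Finset.range N, e k * (w : ℂ) ^ (2 * k)‖ ≤ C * w ^ (2 * N)) :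
    ‖(∫ w : ℝ, Complex.exp (-(x * w ^ 2 / 2)) * F w) -
      ∑ k ∈ Finset.range N, e k * gaussianMoment x k‖ ≤ C * gaussianMoment x N := by
  have hexp (w : ℝ) : Complex.exp (-(x * w ^ 2 / 2)) = (Real.exp (-(x * w ^ 2 / 2)) : ℂ) := by
    push_cast
    rfl
  have hterm (k : ℕ) :
      Integrable fun w : ℝ => e k * ((w ^ (2 * k) * Real.exp (-(x * w ^ 2 / 2)) : ℝ) : ℂ) :=
    (integrable_pow_mul_gaussian hx k).ofReal.const_mul (e k)
  have hsum : ∑ k ∈ Finset.range N, e k * gaussianMoment x k = ∫ w : ℝ,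
      ∑ k ∈ Finset.range N, e k * ((w ^ (2 * k) * Real.exp (-(x * w ^ 2 / 2)) : ℝ) : ℂ) := by
    rw [integral_finsetSum _ fun k _ => hterm k]
    refine Finset.sum_congr rfl fun k _ => ?_
    rw [integral_const_mul, integral_complex_ofReal, gaussianMoment]
  rw [hsum, ← integral_sub hF (integrable_finsetSum _ fun k _ => hterm k), gaussianMoment,
    ← integral_const_mul]
  refine norm_integral_le_of_norm_le ((integrable_pow_mul_gaussian hx N).const_mul C)
    (Eventually.of_forall fun w => ?_)
  calc _ = ‖(Real.exp (-(x * w ^ 2 / 2)) : ℂ) *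
        (F w - ∑ k ∈ Finset.range N, e k * (w : ℂ) ^ (2 * k))‖ := by
        rw [hexp, mul_sub, Finset.mul_sum]
        congr 2
        refine Finset.sum_congr rfl fun k _ => ?_
        push_cast
        ring
    _ ≤ Real.exp (-(x * w ^ 2 / 2)) * (C * w ^ (2 * N)) := by
        rw [norm_mul, Complex.norm_real, Real.norm_of_nonneg (Real.exp_pos _).le]
        exact mul_le_mul_of_nonneg_left (hbound w) (Real.exp_pos _).le
    _ = C * (w ^ (2 * N) * Real.exp (-(x * w ^ 2 / 2))) := by ring

end GaussianMoment

theorem norm_indicator_sub_even_poly_le {E : ℝ → ℂ} {e : ℕ → ℂ} {η C : ℝ} {N : ℕ} (hη : 0 < η)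
    (hbound : ∀ w ∈ Icc (-η) η,
      ‖E w - ∑ k ∈ Finset.range N, e k * (w : ℂ) ^ (2 * k)‖ ≤ C * w ^ (2 * N)) (w : ℝ) :
    ‖(Icc (-η) η).indicator E w - ∑ k ∈ Finset.range N, e k * (w : ℂ) ^ (2 * k)‖ ≤
      (C + ∑ k ∈ Finset.range N, ‖e k‖ * η ^ (2 * k) / η ^ (2 * N)) * w ^ (2 * N) := by
  have hpow (k : ℕ) : 0 ≤ w ^ (2 * k) := (even_two_mul k).pow_nonneg w
  rw [add_mul, Finset.sum_mul]
  by_cases hw : w ∈ Icc (-η) η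
  · rw [indicator_of_mem hw]
    exact (hbound w hw).trans (le_add_of_nonneg_right
      (Finset.sum_nonneg fun k _ => mul_nonneg (by positivity) (hpow N)))
  · have hC : 0 ≤ C := nonneg_of_mul_nonneg_left
      ((norm_nonneg _).trans (hbound η ⟨by linarith, le_rfl⟩)) (by positivity)
    have hη_le : η ≤ |w| := by
      by_contra! hlt
      exact hw (abs_le.1 hlt.le)
    rw [indicator_of_notMem hw, zero_sub, norm_neg]
    refine (norm_sum_le _ _).trans ((Finset.sum_le_sum fun k hk => ?_).trans
      (le_add_of_nonneg_left (mul_nonneg hC (hpow N))))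
    have hratio : |w| ^ (2 * k) ≤ η ^ (2 * k) / η ^ (2 * N) * |w| ^ (2 * N) := by
      obtain ⟨j, rfl⟩ := Nat.exists_eq_add_of_le (Finset.mem_range.1 hk).le
      rw [mul_add, pow_add, pow_add, ← mul_assoc, div_mul_eq_mul_div, div_mul_eq_mul_div,
        le_div_iff₀ (by positivity)]
      calc |w| ^ (2 * k) * (η ^ (2 * k) * η ^ (2 * j))
          ≤ |w| ^ (2 * k) * (η ^ (2 * k) * |w| ^ (2 * j)) := by gcongr
        _ = η ^ (2 * k) * |w| ^ (2 * k) * |w| ^ (2 * j) := by ring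
    rw [norm_mul, norm_pow, Complex.norm_real, Real.norm_eq_abs, mul_div_assoc, mul_assoc,
      ← (even_two_mul N).pow_abs w]
    gcongr

theorem isBigO_integral_gaussian_mul_sub {E : ℝ → ℂ} {e : ℕ → ℂ} {η C : ℝ} {N : ℕ} (hη : 0 < η)
    (hE : ContinuousOn E (Icc (-η) η))
    (hbound : ∀ w ∈ Icc (-η) η,
      ‖E w - ∑ k ∈ Finset.range N, e k * (w : ℂ) ^ (2 * k)‖ ≤ C * w ^ (2 * N)) :
    (fun x : ℝ => (∫ w in (-η)..η, Complex.exp (-(x * w ^ 2 / 2)) * E w) -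
      ∑ k ∈ Finset.range N, e k * gaussianMoment x k) =O[atTop] fun x => gaussianMoment x N := by
  refine IsBigO.of_bound (C + ∑ k ∈ Finset.range N, ‖e k‖ * η ^ (2 * k) / η ^ (2 * N)) ?_
  filter_upwards [eventually_gt_atTop 0] with x hx
  have hindicator : (fun w : ℝ => Complex.exp (-(x * w ^ 2 / 2)) * (Icc (-η) η).indicator E w) =
      (Icc (-η) η).indicator fun w : ℝ => Complex.exp (-(x * w ^ 2 / 2)) * E w :=
    funext fun w => (indicator_mul_right (Icc (-η) η)
      (fun w : ℝ => Complex.exp (-(x * w ^ 2 / 2))) E).symm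
  have hint : Integrable fun w : ℝ =>
      Complex.exp (-(x * w ^ 2 / 2)) * (Icc (-η) η).indicator E w := by
    rw [hindicator, integrable_indicator_iff measurableSet_Icc]
    exact ContinuousOn.integrableOn_compact isCompact_Icc (ContinuousOn.mul (by fun_prop) hE)
  rw [intervalIntegral.integral_of_le (by linarith), ← integral_Icc_eq_integral_Ioc,
    ← integral_indicator measurableSet_Icc, ← hindicator,
    Real.norm_of_nonneg (gaussianMoment_nonneg x N)]
  exact norm_integral_gaussian_mul_sub_le hx hint (norm_indicator_sub_even_poly_le hη hbound)

theorem norm_sub_even_partial_sum_le {e : ℕ → ℂ} {ρ : ℝ} {w E : ℂ}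
    (hsum : Summable fun k => e k * (ρ : ℂ) ^ (2 * k)) (hw : ‖w‖ ≤ ρ)
    (hE : HasSum (fun k => e k * w ^ (2 * k)) E) (hρ : 0 < ρ) (N : ℕ) :
    ‖E - ∑ k ∈ Finset.range N, e k * w ^ (2 * k)‖ ≤
      (∑' k, ‖e (k + N)‖ * ρ ^ (2 * k)) * ‖w‖ ^ (2 * N) := by
  have htail : Summable fun k => ‖e (k + N)‖ * ρ ^ (2 * k) := by
    refine (((summable_nat_add_iff N).2 hsum.norm).mul_right (ρ ^ (2 * N))⁻¹).congr fun k => ?_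
    rw [norm_mul, norm_pow, Complex.norm_real, Real.norm_of_nonneg hρ.le, mul_add 2 k N, pow_add]
    field_simp
  refine HasSum.norm_le_of_bounded ((hasSum_nat_add_iff' N).2 hE) (htail.hasSum.mul_right _)
    fun k => ?_
  rw [norm_mul, norm_pow, mul_add 2 k N, pow_add, mul_assoc]
  gcongr

/-- `P` is a complex primitive of the Gaussian `exp (-x w² / 2) v w` on the ball of radius `R`: it
evaluates integrals of this function along all paths inside the ball at once. -/
def IsGaussianPrimitive (x R : ℝ) (v P : ℂ → ℂ) : Prop :=
  ∀ w ∈ Metric.ball (0 : ℂ) R, HasDerivAt P (Complex.exp (-(x * w ^ 2 / 2)) * v w) w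

/-- The part of the ball of radius `R` to the right of `re w = ρ` inside the cone of slope `1 / 2`
around the positive real axis. On it `re (w²)` is bounded below, so that Gaussians decay. -/
def gaussianCone (R ρ : ℝ) : Set ℂ :=
  {w | w ∈ Metric.ball 0 R ∧ ρ ≤ w.re ∧ |w.im| ≤ w.re / 2}

theorem ofReal_mem_gaussianCone {R ρ : ℝ} (hρ : 0 ≤ ρ) (hR : ρ < R) :
    (ρ : ℂ) ∈ gaussianCone R ρ := by
  refine ⟨?_, le_rfl, ?_⟩
  · rwa [mem_ball_zero_iff, Complex.norm_real, Real.norm_of_nonneg hρ]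
  · rw [Complex.ofReal_im, Complex.ofReal_re, abs_zero]
    positivity

theorem convex_gaussianCone (R ρ : ℝ) : Convex ℝ (gaussianCone R ρ) := by
  have hcone : Convex ℝ {w : ℂ | |w.im| ≤ w.re / 2} := by
    intro w hw z hz s t hs ht _
    simp only [mem_ofPred_eq, abs_le, Complex.add_re, Complex.add_im, Complex.real_smul,
      Complex.re_ofReal_mul, Complex.im_ofReal_mul] at hw hz ⊢
    constructor
    · linarith [mul_le_mul_of_nonneg_left hw.1 hs, mul_le_mul_of_nonneg_left hz.1 ht]
    · linarith [mul_le_mul_of_nonneg_left hw.2 hs, mul_le_mul_of_nonneg_left hz.2 ht]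
  exact (convex_ball 0 R).inter ((convex_halfSpace_re_ge ρ).inter hcone)

theorem norm_cexp_gaussian_le {x R ρ : ℝ} {w : ℂ} (hx : 0 ≤ x) (hρ : 0 ≤ ρ)
    (hw : w ∈ gaussianCone R ρ) :
    ‖Complex.exp (-(x * w ^ 2 / 2))‖ ≤ Real.exp (-(3 * ρ ^ 2 / 8) * x) := by
  obtain ⟨-, hre, him⟩ := hw
  have hre_sq : (-(x * w ^ 2 / 2 : ℂ)).re = -(x * (w.re ^ 2 - w.im ^ 2) / 2) := by
    rw [show (x * w ^ 2 / 2 : ℂ) = ((x / 2 : ℝ) : ℂ) * w ^ 2 by push_cast; ring, Complex.neg_re,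
      Complex.re_ofReal_mul, sq, Complex.mul_re]
    ring
  have him_sq : w.im ^ 2 ≤ (w.re / 2) ^ 2 := by
    rw [← sq_abs w.im]
    gcongr
  have hρ_sq : ρ ^ 2 ≤ w.re ^ 2 := by gcongr
  have hlower : 3 * ρ ^ 2 / 4 ≤ w.re ^ 2 - w.im ^ 2 := by linarith
  rw [Complex.norm_exp, hre_sq, Real.exp_le_exp]
  linarith [mul_le_mul_of_nonneg_left hlower hx]

theorem exists_isGaussianPrimitive {R : ℝ} {v : ℂ → ℂ}
    (hv : DifferentiableOn ℂ v (Metric.ball 0 R)) (x : ℝ) :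
    ∃ P, IsGaussianPrimitive x R v P :=
  (DifferentiableOn.mul (by fun_prop) hv :
    DifferentiableOn ℂ (fun w => Complex.exp (-(x * w ^ 2 / 2)) * v w) _).isExactOn_ball

namespace IsGaussianPrimitive

variable {x R B η ρ : ℝ} {v P : ℂ → ℂ} {p q : ℂ}

theorem norm_sub_le (hP : IsGaussianPrimitive x R v P) (hx : 0 ≤ x) (hρ : 0 ≤ ρ)
    (hB : ∀ w ∈ Metric.ball (0 : ℂ) R, ‖v w‖ ≤ B) (hp : p ∈ gaussianCone R ρ)
    (hq : q ∈ gaussianCone R ρ) :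
    ‖P p - P q‖ ≤ B * (2 * R) * Real.exp (-(3 * ρ ^ 2 / 8) * x) := by
  have hB_nonneg : 0 ≤ B := (norm_nonneg _).trans (hB p hp.1)
  have hmean := (convex_gaussianCone R ρ).norm_image_sub_le_of_norm_hasDerivWithin_le
    (C := Real.exp (-(3 * ρ ^ 2 / 8) * x) * B)
    (fun w hw => (hP w hw.1).hasDerivWithinAt) (fun w hw => ?_) hq hp
  · have hpq : ‖p - q‖ ≤ 2 * R := by
      linarith [_root_.norm_sub_le p q, mem_ball_zero_iff.1 hp.1, mem_ball_zero_iff.1 hq.1]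
    calc ‖P p - P q‖ ≤ Real.exp (-(3 * ρ ^ 2 / 8) * x) * B * (2 * R) := by
          exact hmean.trans (by gcongr)
      _ = B * (2 * R) * Real.exp (-(3 * ρ ^ 2 / 8) * x) := by ring
  · rw [norm_mul]
    exact mul_le_mul (norm_cexp_gaussian_le hx hρ hw) (hB w hw.1) (norm_nonneg _)
      (Real.exp_pos _).le

theorem comp_neg (hP : IsGaussianPrimitive x R v P) :
    IsGaussianPrimitive x R (fun w => -v (-w)) fun w => P (-w) := by
  intro w hw
  refine ((hP (-w) (by simpa using hw)).comp w (hasDerivAt_neg w)).congr_deriv ?_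
  rw [neg_sq]
  ring

theorem norm_sub_sub_le (hP : IsGaussianPrimitive x R v P) (hx : 0 ≤ x) (hη : 0 < η) (hηR : η < R)
    (hB : ∀ w ∈ Metric.ball (0 : ℂ) R, ‖v w‖ ≤ B) (hp : p ∈ gaussianCone R η)
    (hq : -q ∈ gaussianCone R η) :
    ‖P p - P q - (P η - P (-η))‖ ≤ 2 * (B * (2 * R)) * Real.exp (-(3 * η ^ 2 / 8) * x) := by
  have hη_mem := ofReal_mem_gaussianCone hη.le hηR
  have hright := hP.norm_sub_le hx hη.le hB hp hη_mem
  have hleft := hP.comp_neg.norm_sub_le hx hη.le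
    (fun w hw => by rw [norm_neg]; exact hB _ (by simpa using hw)) hq hη_mem
  rw [neg_neg] at hleft
  calc ‖P p - P q - (P η - P (-η))‖ = ‖(P p - P η) - (P q - P (-η))‖ := by rw [sub_sub_sub_comm]
    _ ≤ ‖P p - P η‖ + ‖P q - P (-η)‖ := _root_.norm_sub_le _ _
    _ ≤ 2 * (B * (2 * R)) * Real.exp (-(3 * η ^ 2 / 8) * x) := by linarith

theorem integral_eq (hP : IsGaussianPrimitive x R v P) (hv : ContinuousOn v (Metric.ball 0 R))
    (hη : 0 ≤ η) (hηR : η < R) :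
    ∫ w in (-η)..η, Complex.exp (-(x * w ^ 2 / 2)) * v w = P η - P (-η) := by
  have hmem : ∀ w ∈ uIcc (-η) η, (w : ℂ) ∈ Metric.ball (0 : ℂ) R := by
    intro w hw
    rw [uIcc_of_le (by linarith)] at hw
    rw [mem_ball_zero_iff, Complex.norm_real, Real.norm_eq_abs]
    exact (abs_le.2 hw).trans_lt hηR
  have hint : IntervalIntegrable (fun w : ℝ => Complex.exp (-(x * w ^ 2 / 2)) * v w) volume
      (-η) η :=
    (ContinuousOn.mul (by fun_prop)
      (hv.comp Complex.continuous_ofReal.continuousOn hmem)).intervalIntegrable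
  rw [intervalIntegral.integral_eq_sub_of_hasDerivAt (f := fun w : ℝ => P w)
    (fun w hw => (hP w (hmem w hw)).comp_ofReal) hint, Complex.ofReal_neg]

theorem integral_even_part_eq (hP : IsGaussianPrimitive x R v P)
    (hv : ContinuousOn v (Metric.ball 0 R)) (hη : 0 ≤ η) (hηR : η < R) :
    ∫ w in (-η)..η, Complex.exp (-(x * w ^ 2 / 2)) * ((v w + v (-w)) / 2) = P η - P (-η) := by
  have heven : IsGaussianPrimitive x R (fun w => (v w + v (-w)) / 2)
      fun w => (P w - P (-w)) / 2 := by
    intro w hw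
    refine (((hP w hw).sub (hP.comp_neg w hw)).div_const 2).congr_deriv ?_
    ring
  have hv_neg : ContinuousOn (fun w => v (-w)) (Metric.ball 0 R) :=
    hv.comp continuous_neg.continuousOn fun w hw => by simpa using hw
  rw [heven.integral_eq ((hv.add hv_neg).div_const 2) hη hηR, neg_neg]
  ring

end IsGaussianPrimitive

theorem isBigO_integral_gaussian_even_part {v : ℂ → ℂ} {R η : ℝ} {e : ℕ → ℂ} (hη : 0 < η)
    (hηR : η < R) (hv : ContinuousOn v (Metric.ball 0 R))
    (he : ∀ w ∈ Metric.ball (0 : ℂ) R, HasSum (fun k => e k * w ^ (2 * k)) ((v w + v (-w)) / 2))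
    (N : ℕ) :
    (fun x : ℝ => (∫ w in (-η)..η, Complex.exp (-(x * w ^ 2 / 2)) * ((v w + v (-w)) / 2)) -
      ∑ k ∈ Finset.range N, e k * gaussianMoment x k) =O[atTop] fun x => gaussianMoment x N := by
  have hmem : ∀ w : ℝ, w ∈ Icc (-η) η → (w : ℂ) ∈ Metric.ball (0 : ℂ) R := by
    intro w hw
    rw [mem_ball_zero_iff, Complex.norm_real, Real.norm_eq_abs]
    exact (abs_le.2 hw).trans_lt hηR
  have hv_pos : ContinuousOn (fun w : ℝ => v w) (Icc (-η) η) :=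
    hv.comp Complex.continuous_ofReal.continuousOn hmem
  have hv_neg : ContinuousOn (fun w : ℝ => v (-w)) (Icc (-η) η) :=
    hv.comp (by fun_prop) fun w hw => by simpa using hmem w hw
  refine isBigO_integral_gaussian_mul_sub hη ((hv_pos.add hv_neg).div_const 2)
    (C := ∑' k, ‖e (k + N)‖ * η ^ (2 * k)) fun w hw => ?_
  rw [← (even_two_mul N).pow_abs w, ← Real.norm_eq_abs, ← Complex.norm_real]
  refine norm_sub_even_partial_sum_le (he η (hmem η ⟨by linarith, le_rfl⟩)).summable ?_
    (he w (hmem w hw)) hη N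
  rw [Complex.norm_real, Real.norm_eq_abs]
  exact abs_le.2 hw

theorem isBigO_sub_gaussianMoment_of_path {v : ℂ → ℂ} {R B ρ : ℝ} {e : ℕ → ℂ} {p q : ℂ}
    {J : ℝ → ℂ} (hρ : 0 < ρ) (hv : DifferentiableOn ℂ v (Metric.ball 0 R))
    (hB : ∀ w ∈ Metric.ball (0 : ℂ) R, ‖v w‖ ≤ B)
    (he : ∀ w ∈ Metric.ball (0 : ℂ) R, HasSum (fun k => e k * w ^ (2 * k)) ((v w + v (-w)) / 2))
    (hp : p ∈ gaussianCone R ρ) (hq : -q ∈ gaussianCone R ρ)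
    (hJ : ∀ x P, IsGaussianPrimitive x R v P → J x = P p - P q) (N : ℕ) :
    (fun x => J x - ∑ k ∈ Finset.range N, e k * gaussianMoment x k) =O[atTop]
      fun x => gaussianMoment x N := by
  have hρR : ρ < R :=
    hp.2.1.trans_lt ((Complex.re_le_norm p).trans_lt (mem_ball_zero_iff.1 hp.1))
  -- The path may be replaced by a real interval at the cost of two pieces inside the cones, where
  -- the Gaussian is exponentially small.
  have hpath : (fun x : ℝ => J x - ∫ w in (-ρ)..ρ, Complex.exp (-(x * w ^ 2 / 2)) *
      ((v w + v (-w)) / 2)) =O[atTop] fun x => gaussianMoment x N := by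
    refine IsBigO.trans (IsBigO.of_bound (2 * (B * (2 * R))) ?_)
      (exp_neg_isBigO_gaussianMoment (by positivity : 0 < 3 * ρ ^ 2 / 8) N)
    filter_upwards [eventually_gt_atTop 0] with x hx
    obtain ⟨P, hP⟩ := exists_isGaussianPrimitive hv x
    rw [hJ x P hP, hP.integral_even_part_eq hv.continuousOn hρ.le hρR,
      Real.norm_of_nonneg (Real.exp_pos _).le]
    exact hP.norm_sub_sub_le hx.le hρ hρR hB hp hq
  exact (hpath.add (isBigO_integral_gaussian_even_part hρ hρR hv.continuousOn he N)).congr_left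
    fun x => by ring

/-! ### Steepest descent at the saddle point -/

theorem one_add_mul_I_mem_slitPlane (τ : ℝ) : (1 + τ * I : ℂ) ∈ slitPlane := by
  simpa using add_mul_I_mem_slitPlane one_pos τ

theorem hasDerivAt_log_one_add_mul_I (τ : ℝ) :
    HasDerivAt (fun τ : ℝ => Complex.log (1 + τ * I)) (I / (1 + τ * I)) τ := by
  have hline := (((hasDerivAt_id (τ : ℂ)).mul_const I).const_add 1).comp_ofReal
  exact (hline.clog_real (one_add_mul_I_mem_slitPlane τ)).congr_deriv (by simp)

/-- The integrand of the Bromwich integral of the Wright function on the vertical line through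
`exp u0`, parametrized by `t = exp u0 * (1 + τ I)` and divided by its exponential size at the saddle
point. -/
def saddleIntegrand (lam a u0 x τ : ℝ) : ℂ :=
  Complex.exp (x * (phaseC lam a (u0 + Complex.log (1 + τ * I)) - phaseC lam a u0)) / (1 + τ * I)

theorem continuous_saddleIntegrand (lam a u0 x : ℝ) : Continuous (saddleIntegrand lam a u0 x) := by
  have hlog : Continuous fun τ : ℝ => Complex.log (1 + τ * I) :=
    continuous_iff_continuousAt.2 fun τ => (hasDerivAt_log_one_add_mul_I τ).continuousAt
  unfold saddleIntegrand phaseC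
  exact Continuous.div (by fun_prop) (by fun_prop) fun τ =>
    Complex.slitPlane_ne_zero (one_add_mul_I_mem_slitPlane τ)

theorem eventually_mem_gaussianCone {f : ℝ → ℂ} {m R : ℝ} (hm : 0 < m) (hR : 0 < R)
    (hf : HasDerivAt f m 0) (hf_zero : f 0 = 0) :
    ∀ᶠ τ : ℝ in 𝓝[>] 0, f τ ∈ gaussianCone R (m / 2 * τ) := by
  have hlinear := (hasDerivAt_iff_isLittleO.1 hf).def (show 0 < m / 4 by positivity)
  have hball : ∀ᶠ τ in 𝓝 0, f τ ∈ Metric.ball 0 R :=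
    hf.continuousAt.eventually_mem (by simpa [hf_zero] using Metric.ball_mem_nhds (0 : ℂ) hR)
  filter_upwards [hlinear.filter_mono nhdsWithin_le_nhds, hball.filter_mono nhdsWithin_le_nhds,
    self_mem_nhdsWithin] with τ hτ hτ_ball hτ_pos
  rw [hf_zero, sub_zero, sub_zero, Real.norm_of_nonneg (le_of_lt hτ_pos)] at hτ
  have hre := (Complex.abs_re_le_norm _).trans hτ
  have him := (Complex.abs_im_le_norm _).trans hτ
  simp only [Complex.sub_re, Complex.sub_im, Complex.real_smul, Complex.re_ofReal_mul,
    Complex.im_ofReal_mul, Complex.ofReal_re, Complex.ofReal_im, mul_zero, sub_zero] at hre him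
  have hmτ : 0 < m * τ := mul_pos hm hτ_pos
  have hre_lower := (abs_le.1 hre).1
  exact ⟨hτ_ball, by linarith, by linarith⟩

/-- The coordinate `w` of the quadratic normal form `-w²/2` along the vertical line through the
saddle point, where `Ψ` is the square root of the normalized phase. -/
def saddleCoord (lam a u0 : ℝ) (Ψ : ℂ → ℂ) (τ : ℝ) : ℂ :=
  Ψ (Complex.log (1 + τ * I)) / invSqrtNeg lam a u0

theorem invSqrtNeg_ne_zero {lam a u0 : ℝ} (h2pos : 0 < phaseDeriv lam a u0 2) :
    invSqrtNeg lam a u0 ≠ 0 :=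
  div_ne_zero Complex.I_ne_zero (Complex.ofReal_ne_zero.2 (Real.sqrt_pos.2 h2pos).ne')

namespace IsSaddleReversion

variable {lam a u0 : ℝ} {Ψ S : ℂ → ℂ}

theorem saddleCoord_zero (hS : IsSaddleReversion lam a u0 Ψ S) :
    saddleCoord lam a u0 Ψ 0 = 0 := by
  simp [saddleCoord, hS.sqrt_zero]

theorem hasDerivAt_saddleCoord_zero (hS : IsSaddleReversion lam a u0 Ψ S)
    (h2pos : 0 < phaseDeriv lam a u0 2) :
    HasDerivAt (saddleCoord lam a u0 Ψ) (Real.sqrt (phaseDeriv lam a u0 2) : ℂ) 0 := by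
  have hsqrt : (Real.sqrt (phaseDeriv lam a u0 2) : ℂ) ≠ 0 :=
    Complex.ofReal_ne_zero.2 (Real.sqrt_pos.2 h2pos).ne'
  have hΨ := hS.analyticAt_sqrt.differentiableAt.hasDerivAt.comp_of_eq (0 : ℝ)
    (hasDerivAt_log_one_add_mul_I 0) (by simp)
  refine (hΨ.div_const (invSqrtNeg lam a u0)).congr_deriv ?_
  rw [hS.deriv_sqrt, invSqrtNeg]
  field_simp
  simp

theorem neg_mul_saddleCoord_sq (hS : IsSaddleReversion lam a u0 Ψ S)
    (h2pos : 0 < phaseDeriv lam a u0 2) (x τ : ℝ) :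
    -(x * saddleCoord lam a u0 Ψ τ ^ 2 / 2) =
      x * (phaseC lam a (u0 + Complex.log (1 + τ * I)) - phaseC lam a u0) := by
  rw [← half_phaseDeriv_mul_normalizedPhase h2pos, ← hS.sqrt_sq, saddleCoord, div_pow,
    invSqrtNeg_sq h2pos]
  field_simp

theorem eventually_hasDerivAt_comp_saddleCoord (hS : IsSaddleReversion lam a u0 Ψ S)
    (h2pos : 0 < phaseDeriv lam a u0 2) :
    ∀ᶠ τ : ℝ in 𝓝 0, ∀ (x : ℝ) (P : ℂ → ℂ),
      HasDerivAt P (Complex.exp (-(x * saddleCoord lam a u0 Ψ τ ^ 2 / 2)) *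
        deriv (saddleReversion lam a u0 S) (saddleCoord lam a u0 Ψ τ)) (saddleCoord lam a u0 Ψ τ) →
      HasDerivAt (fun τ => P (saddleCoord lam a u0 Ψ τ)) (saddleIntegrand lam a u0 x τ * I) τ := by
  have hlog : Tendsto (fun τ : ℝ => Complex.log (1 + τ * I)) (𝓝 0) (𝓝 0) := by
    simpa using (hasDerivAt_log_one_add_mul_I 0).continuousAt.tendsto
  have hcoord : Tendsto (saddleCoord lam a u0 Ψ) (𝓝 0) (𝓝 0) := by
    simpa [hS.saddleCoord_zero] using
      (hS.hasDerivAt_saddleCoord_zero h2pos).continuousAt.tendsto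
  filter_upwards [hlog.eventually hS.analyticAt_sqrt.eventually_analyticAt,
    (hlog.eventually hS.left_inv).eventually_nhds,
    hcoord.eventually (hS.isLocalReversion h2pos).analyticAt.eventually_analyticAt]
    with τ hΨ hinv hu x P hP
  have hcoord_deriv : DifferentiableAt ℝ (saddleCoord lam a u0 Ψ) τ :=
    ((hΨ.differentiableAt.hasDerivAt.comp τ (hasDerivAt_log_one_add_mul_I τ)).div_const
      _).differentiableAt
  have hchain : deriv (saddleReversion lam a u0 S) (saddleCoord lam a u0 Ψ τ) *
      deriv (saddleCoord lam a u0 Ψ) τ = I / (1 + τ * I) := by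
    refine (hu.differentiableAt.hasDerivAt.comp τ hcoord_deriv.hasDerivAt).unique
      (((hasDerivAt_log_one_add_mul_I τ).const_add (u0 : ℂ)).congr_of_eventuallyEq ?_)
    filter_upwards [hinv] with σ hσ
    rw [Function.comp_apply, saddleReversion, saddleCoord,
      mul_div_cancel₀ _ (invSqrtNeg_ne_zero h2pos), hσ]
  refine (hP.comp τ hcoord_deriv.hasDerivAt).congr_deriv ?_
  rw [mul_assoc, hchain, hS.neg_mul_saddleCoord_sq h2pos, saddleIntegrand]
  ring

theorem exists_integral_saddleIntegrand_eq (hS : IsSaddleReversion lam a u0 Ψ S)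
    (h2pos : 0 < phaseDeriv lam a u0 2) {R : ℝ} (hR : 0 < R) :
    ∃ δ > 0, ∃ ρ > 0, saddleCoord lam a u0 Ψ δ ∈ gaussianCone R ρ ∧
      -saddleCoord lam a u0 Ψ (-δ) ∈ gaussianCone R ρ ∧
      ∀ x P, IsGaussianPrimitive x R (deriv (saddleReversion lam a u0 S)) P →
        ∫ τ in (-δ)..δ, saddleIntegrand lam a u0 x τ * I =
          P (saddleCoord lam a u0 Ψ δ) - P (saddleCoord lam a u0 Ψ (-δ)) := by
  set g := saddleCoord lam a u0 Ψ
  have hsqrt : 0 < Real.sqrt (phaseDeriv lam a u0 2) := Real.sqrt_pos.2 h2pos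
  have hg_deriv := hS.hasDerivAt_saddleCoord_zero h2pos
  have hg_reflect : HasDerivAt (fun τ => -g (-τ)) (Real.sqrt (phaseDeriv lam a u0 2) : ℂ) 0 :=
    (hg_deriv.scomp_of_eq (0 : ℝ) (hasDerivAt_neg 0) neg_zero.symm).neg.congr_deriv (by simp)
  have hg_ball : ∀ᶠ τ in 𝓝 0, g τ ∈ Metric.ball 0 R :=
    hg_deriv.continuousAt.eventually_mem
      (by simpa [hS.saddleCoord_zero] using Metric.ball_mem_nhds (0 : ℂ) hR)
  obtain ⟨ε, hε, hnear⟩ := Metric.eventually_nhds_iff_ball.1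
    (hg_ball.and (hS.eventually_hasDerivAt_comp_saddleCoord h2pos))
  obtain ⟨δ, hright, hleft, hδ, hδε⟩ :=
    ((eventually_mem_gaussianCone hsqrt hR hg_deriv hS.saddleCoord_zero).and
      ((eventually_mem_gaussianCone hsqrt hR hg_reflect (by simp [g, hS.saddleCoord_zero])).and
        (Ioo_mem_nhdsGT hε))).exists
  refine ⟨δ, hδ, _, by positivity, hright, hleft, fun x P hP => ?_⟩
  refine intervalIntegral.integral_eq_sub_of_hasDerivAt (f := fun τ => P (g τ)) (fun τ hτ => ?_)
    (((continuous_saddleIntegrand lam a u0 x).mul continuous_const).intervalIntegrable _ _)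
  rw [uIcc_of_le (by linarith)] at hτ
  obtain ⟨hτ_ball, hτ_deriv⟩ := hnear τ
    (by rw [mem_ball_zero_iff, Real.norm_eq_abs]; exact (abs_le.2 hτ).trans_lt hδε)
  exact hτ_deriv x P (hP _ hτ_ball)

theorem exists_isBigO_integral_saddleIntegrand (hS : IsSaddleReversion lam a u0 Ψ S)
    (h2pos : 0 < phaseDeriv lam a u0 2) :
    ∃ δ > 0, ∀ N : ℕ, (fun x : ℝ => (∫ τ in (-δ)..δ, saddleIntegrand lam a u0 x τ) -
      (((∑ k ∈ Finset.range N, (-1) ^ k * reversionCoeff lam a u0 S k * gaussianMoment x k) /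
        Real.sqrt (phaseDeriv lam a u0 2) : ℝ) : ℂ)) =O[atTop] fun x => gaussianMoment x N := by
  have hsqrt : (Real.sqrt (phaseDeriv lam a u0 2) : ℂ) ≠ 0 :=
    Complex.ofReal_ne_zero.2 (Real.sqrt_pos.2 h2pos).ne'
  set v := deriv (saddleReversion lam a u0 S)
  have hu := (hS.isLocalReversion h2pos).analyticAt
  obtain ⟨R, hR, hball⟩ := Metric.eventually_nhds_iff_ball.1
    ((hS.hasSum_even_part_deriv_saddleReversion h2pos).and (hu.eventually_analyticAt.and
      (hu.deriv.continuousAt.norm.eventually_le_const (lt_add_one ‖v 0‖))))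
  obtain ⟨δ, hδ, ρ, hρ, hright, hleft, hpath⟩ := hS.exists_integral_saddleIntegrand_eq h2pos hR
  refine ⟨δ, hδ, fun N => ?_⟩
  have hgauss := isBigO_sub_gaussianMoment_of_path
    (e := fun k => invSqrtNeg lam a u0 * ((-1) ^ k * (reversionCoeff lam a u0 S k : ℂ))) hρ
    (fun w hw => (hball w hw).2.1.deriv.differentiableAt.differentiableWithinAt)
    (fun w hw => (hball w hw).2.2) (fun w hw => by simpa only [mul_assoc] using (hball w hw).1)
    hright hleft hpath N
  refine (hgauss.const_mul_left I⁻¹).congr_left fun x => ?_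
  rw [mul_sub, intervalIntegral.integral_mul_const, Finset.mul_sum, Finset.sum_div,
    Complex.ofReal_sum]
  congr 1
  · field_simp
  · refine Finset.sum_congr rfl fun k _ => ?_
    rw [invSqrtNeg]
    push_cast
    field_simp

end IsSaddleReversion

theorem sin_mul_le_mul_sin {k θ : ℝ} (hk : 1 ≤ k) (hθ : 0 ≤ θ) (hθ_le : θ ≤ π / 2) :
    Real.sin (k * θ) ≤ k * Real.sin θ := by
  rcases le_or_gt (k * θ) π with hkθ | hkθ
  · have hderiv (t : ℝ) : HasDerivAt (fun t => k * Real.sin t - Real.sin (k * t))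
        (k * (Real.cos t - Real.cos (k * t))) t := by
      refine (((Real.hasDerivAt_sin t).const_mul k).sub
        ((hasDerivAt_id t).const_mul k).sin).congr_deriv ?_
      rw [id, mul_one]
      ring
    have hmono : MonotoneOn (fun t => k * Real.sin t - Real.sin (k * t)) (Icc 0 θ) := by
      refine monotoneOn_of_deriv_nonneg (convex_Icc 0 θ) (by fun_prop) (by fun_prop) fun t ht => ?_
      rw [interior_Icc] at ht
      have hkt : k * t ≤ π := (by gcongr; exact ht.2.le : k * t ≤ k * θ).trans hkθ
      rw [(hderiv t).deriv]
      exact mul_nonneg (by linarith) (sub_nonneg.2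
        (Real.cos_le_cos_of_nonneg_of_le_pi ht.1.le hkt (le_mul_of_one_le_left ht.1.le hk)))
    simpa using hmono ⟨le_rfl, hθ⟩ ⟨hθ, le_rfl⟩ hθ
  · have hk_sin : 1 ≤ k * (2 / π * θ) := by
      rw [show k * (2 / π * θ) = 2 * (k * θ) / π by ring, le_div_iff₀ Real.pi_pos]
      linarith [Real.pi_pos]
    exact (Real.sin_le_one _).trans (hk_sin.trans (by gcongr; exact Real.mul_le_sin hθ hθ_le))

theorem log_one_add_tan_mul_I {θ : ℝ} (hθ : θ ∈ Ioo (-(π / 2)) (π / 2)) :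
    Complex.log (1 + Real.tan θ * I) = ((-Real.log (Real.cos θ) : ℝ) : ℂ) + θ * I := by
  have hcos : 0 < Real.cos θ := Real.cos_pos_of_mem_Ioo hθ
  have hcos_ne : Complex.cos θ ≠ 0 := by
    rw [← Complex.ofReal_cos]
    exact_mod_cast hcos.ne'
  rw [← Complex.log_exp (x := ((-Real.log (Real.cos θ) : ℝ) : ℂ) + θ * I)
    (by simp; linarith [hθ.1, Real.pi_pos]) (by simp; linarith [hθ.2, Real.pi_pos]),
    Complex.exp_add, ← Complex.ofReal_exp, Real.exp_neg, Real.exp_log hcos, Complex.exp_mul_I,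
    ← Complex.ofReal_cos, ← Complex.ofReal_sin, Real.tan_eq_sin_div_cos]
  congr 1
  push_cast
  field_simp

theorem re_phaseC (lam a : ℝ) (u : ℂ) :
    (phaseC lam a u).re = (Real.exp u.re * Real.cos u.im -
      Real.exp (-lam * u.re) * Real.cos (lam * u.im)) / 2 - a * u.re := by
  have hre : (-(lam : ℂ) * u).re = -lam * u.re := by simp
  have him : (-(lam : ℂ) * u).im = -(lam * u.im) := by simp
  rw [phaseC, Complex.sub_re, Complex.re_ofReal_mul, ← Complex.ofReal_ofNat,
    Complex.div_ofReal_re, Complex.sub_re, Complex.exp_re, Complex.exp_re, hre, him, Real.cos_neg]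

theorem phaseC_ofReal (lam a u : ℝ) : phaseC lam a u = (phase lam a u : ℂ) := by
  simp [phaseC, phase]

/-- The real part of the phase on the vertical line through `exp u0`, relative to its value at the
saddle point, as a function of the angle `θ` in the parametrization `t = exp u0 * (1 + tan θ I)`. -/
def phaseDecay (lam a u0 θ : ℝ) : ℝ :=
  Real.exp (-lam * u0) / 2 * (1 - Real.cos θ ^ lam * Real.cos (lam * θ)) +
    a * Real.log (Real.cos θ)

theorem re_phaseC_sub_eq_phaseDecay {θ : ℝ} (lam a u0 : ℝ) (hθ : θ ∈ Ioo (-(π / 2)) (π / 2)) :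
    (phaseC lam a (u0 + Complex.log (1 + Real.tan θ * I)) - phaseC lam a u0).re =
      phaseDecay lam a u0 θ := by
  have hcos : 0 < Real.cos θ := Real.cos_pos_of_mem_Ioo hθ
  set u : ℂ := u0 + (((-Real.log (Real.cos θ) : ℝ) : ℂ) + θ * I) with hu
  have hre : u.re = u0 - Real.log (Real.cos θ) := by simp [hu, sub_eq_add_neg]
  have him : u.im = θ := by simp [hu]
  have hexp : Real.exp (u0 - Real.log (Real.cos θ)) * Real.cos θ = Real.exp u0 := by
    rw [Real.exp_sub, Real.exp_log hcos, div_mul_cancel₀ _ hcos.ne']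
  have hexp_lam : Real.exp (-lam * (u0 - Real.log (Real.cos θ))) =
      Real.exp (-lam * u0) * Real.cos θ ^ lam := by
    rw [Real.rpow_def_of_pos hcos, ← Real.exp_add]
    ring_nf
  rw [log_one_add_tan_mul_I hθ, ← hu, Complex.sub_re, re_phaseC, hre, him, hexp, hexp_lam,
    phaseC_ofReal, Complex.ofReal_re, phase, phaseDecay]
  ring

theorem phaseDecay_neg (lam a u0 θ : ℝ) : phaseDecay lam a u0 (-θ) = phaseDecay lam a u0 θ := by
  simp [phaseDecay]

theorem phaseDecay_zero (lam a u0 : ℝ) : phaseDecay lam a u0 0 = 0 := by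
  simp [phaseDecay]

theorem hasDerivAt_phaseDecay (lam a u0 : ℝ) {θ : ℝ} (hcos : 0 < Real.cos θ) :
    HasDerivAt (phaseDecay lam a u0)
      ((lam * Real.exp (-lam * u0) * Real.cos θ ^ lam * Real.sin ((1 + lam) * θ) -
        2 * a * Real.sin θ) / (2 * Real.cos θ)) θ := by
  have hrpow := (Real.hasDerivAt_cos θ).rpow_const (p := lam) (Or.inl hcos.ne')
  have hcos_lam := ((hasDerivAt_id θ).const_mul lam).cos
  refine ((((hrpow.mul hcos_lam).const_sub 1).const_mul (Real.exp (-lam * u0) / 2)).add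
    (((Real.hasDerivAt_cos θ).log hcos.ne').const_mul a)).congr_deriv ?_
  rw [Real.rpow_sub_one hcos.ne', add_mul, one_mul, Real.sin_add, id, mul_one]
  field_simp
  ring

theorem saddle_mul_sin_lt {lam a u0 θ : ℝ} (ha : 0 < a) (hlam : -1 < lam)
    (hu0 : u0 ∈ realSaddles lam a) (h2pos : 0 < phaseDeriv lam a u0 2) (hθ : θ ∈ Ioo 0 (π / 2)) :
    lam * Real.exp (-lam * u0) * Real.cos θ ^ lam * Real.sin ((1 + lam) * θ) <
      2 * a * Real.sin θ := by
  have hsaddle : Real.exp u0 + lam * Real.exp (-lam * u0) = 2 * a := hu0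
  have hcos : 0 < Real.cos θ := Real.cos_pos_of_mem_Ioo ⟨by linarith [hθ.1, hθ.2], hθ.2⟩
  have hsin : 0 < Real.sin θ := Real.sin_pos_of_pos_of_lt_pi hθ.1 (by linarith [hθ.2, Real.pi_pos])
  rcases le_or_gt lam 0 with hlam_nonpos | hlam_pos
  · have hsin_nonneg : 0 ≤ Real.sin ((1 + lam) * θ) :=
      Real.sin_nonneg_of_nonneg_of_le_pi (mul_nonneg (by linarith) hθ.1.le)
        (by nlinarith [hθ.1, hθ.2, Real.pi_pos])
    have hleft : lam * Real.exp (-lam * u0) * Real.cos θ ^ lam * Real.sin ((1 + lam) * θ) ≤ 0 := by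
      refine mul_nonpos_of_nonpos_of_nonneg ?_ hsin_nonneg
      exact mul_nonpos_of_nonpos_of_nonneg
        (mul_nonpos_of_nonpos_of_nonneg hlam_nonpos (Real.exp_pos _).le) (by positivity)
    exact hleft.trans_lt (by positivity)
  · have hsecond : lam ^ 2 * Real.exp (-lam * u0) < Real.exp u0 := by
      rw [phaseDeriv_two] at h2pos
      linarith
    calc lam * Real.exp (-lam * u0) * Real.cos θ ^ lam * Real.sin ((1 + lam) * θ)
        ≤ lam * Real.exp (-lam * u0) * Real.cos θ ^ lam * ((1 + lam) * Real.sin θ) := by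
          gcongr
          exact sin_mul_le_mul_sin (by linarith) hθ.1.le hθ.2.le
      _ ≤ lam * Real.exp (-lam * u0) * 1 * ((1 + lam) * Real.sin θ) := by
          gcongr
          exact Real.rpow_le_one hcos.le (Real.cos_le_one θ) hlam_pos.le
      _ = (lam ^ 2 * Real.exp (-lam * u0) + lam * Real.exp (-lam * u0)) * Real.sin θ := by ring
      _ < 2 * a * Real.sin θ := by
          gcongr
          linarith

theorem strictAntiOn_phaseDecay {lam a u0 : ℝ} (ha : 0 < a) (hlam : -1 < lam)
    (hu0 : u0 ∈ realSaddles lam a) (h2pos : 0 < phaseDeriv lam a u0 2) :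
    StrictAntiOn (phaseDecay lam a u0) (Ico 0 (π / 2)) := by
  have hcos : ∀ θ ∈ Ico 0 (π / 2), 0 < Real.cos θ := fun θ hθ =>
    Real.cos_pos_of_mem_Ioo ⟨by linarith [hθ.1, hθ.2], hθ.2⟩
  refine strictAntiOn_of_deriv_neg (convex_Ico _ _) (fun θ hθ =>
    (hasDerivAt_phaseDecay lam a u0 (hcos θ hθ)).continuousAt.continuousWithinAt) fun θ hθ => ?_
  rw [interior_Ico] at hθ
  have hcos_pos := hcos θ ⟨hθ.1.le, hθ.2⟩
  rw [(hasDerivAt_phaseDecay lam a u0 hcos_pos).deriv]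
  exact div_neg_of_neg_of_pos (sub_neg.2 (saddle_mul_sin_lt ha hlam hu0 h2pos hθ)) (by positivity)

theorem exists_re_phaseC_sub_le_neg {lam a u0 δ : ℝ} (ha : 0 < a) (hlam : -1 < lam)
    (hu0 : u0 ∈ realSaddles lam a) (h2pos : 0 < phaseDeriv lam a u0 2) (hδ : 0 < δ) :
    ∃ κ > 0, ∀ τ : ℝ, δ ≤ |τ| →
      (phaseC lam a (u0 + Complex.log (1 + τ * I)) - phaseC lam a u0).re ≤ -κ := by
  have hanti := strictAntiOn_phaseDecay ha hlam hu0 h2pos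
  have harctan : 0 < Real.arctan δ := Real.arctan_pos.2 hδ
  have hmem : Real.arctan δ ∈ Ico 0 (π / 2) := ⟨harctan.le, Real.arctan_lt_pi_div_two δ⟩
  refine ⟨-phaseDecay lam a u0 (Real.arctan δ), ?_, fun τ hτ => ?_⟩
  · have hdecay := hanti ⟨le_rfl, by positivity⟩ hmem harctan
    rw [phaseDecay_zero] at hdecay
    linarith
  · have hre := re_phaseC_sub_eq_phaseDecay lam a u0 (Real.arctan_mem_Ioo τ)
    rw [Real.tan_arctan] at hre
    have habs : phaseDecay lam a u0 (Real.arctan τ) = phaseDecay lam a u0 (Real.arctan |τ|) := by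
      rcases abs_choice τ with hτ_abs | hτ_abs
      · rw [hτ_abs]
      · rw [hτ_abs, Real.arctan_neg, phaseDecay_neg]
    have hle : Real.arctan δ ≤ Real.arctan |τ| := Real.arctan_strictMono.monotone hτ
    rw [hre, habs, neg_neg]
    exact hanti.antitoneOn hmem ⟨harctan.le.trans hle, Real.arctan_lt_pi_div_two _⟩ hle

theorem wrightKernel_exp {lam mu z : ℝ} {v : ℂ} (hv : v.im ∈ Ioc (-π) π) :
    wrightKernel lam mu z (Complex.exp v) =
      Complex.exp (Complex.exp v + z * Complex.exp (-(lam : ℂ) * v) - mu * v) := by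
  have hcpow (s : ℂ) : Complex.exp v ^ s = Complex.exp (s * v) := by
    rw [Complex.cpow_def_of_ne_zero (Complex.exp_ne_zero v), Complex.log_exp hv.1 hv.2, mul_comm]
  rw [wrightKernel, hankelKernel, hcpow, hcpow, ← Complex.exp_add, ← Complex.exp_add]
  ring_nf

/-- The substitution `t = (x/2) e^u` turns both exponentials of the kernel into multiples of `x`. -/
theorem mul_wrightKernel_half_mul_exp {lam a x : ℝ} {u : ℂ} (hx : 0 < x)
    (hu : u.im ∈ Ioc (-π) π) :
    (((x / 2) ^ (a * x) : ℝ) : ℂ) * (((x / 2 : ℝ) : ℂ) * Complex.exp u) *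
      wrightKernel lam (a * x + 1) (-((x / 2) ^ (lam + 1))) (((x / 2 : ℝ) : ℂ) * Complex.exp u) =
      Complex.exp (x * phaseC lam a u) := by
  set L := Real.log (x / 2) with hL
  have hhalf : ((x / 2 : ℝ) : ℂ) = Complex.exp L := by
    rw [hL, ← Complex.ofReal_exp, Real.exp_log (half_pos hx)]
  have hrpow (s : ℝ) : (((x / 2) ^ s : ℝ) : ℂ) = Complex.exp (L * s) := by
    rw [Real.rpow_def_of_pos (half_pos hx), Complex.ofReal_exp, Complex.ofReal_mul]
  have hscaled : Complex.exp (L * ((lam + 1 : ℝ) : ℂ)) * Complex.exp (-(lam : ℂ) * (L + u)) =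
      Complex.exp L * Complex.exp (-(lam : ℂ) * u) := by
    rw [← Complex.exp_add, ← Complex.exp_add]
    push_cast
    ring_nf
  have hphase : (x : ℂ) * phaseC lam a u = Complex.exp L * Complex.exp u -
      Complex.exp L * Complex.exp (-(lam : ℂ) * u) - a * x * u := by
    rw [phaseC, ← hhalf]
    push_cast
    ring
  rw [hhalf, ← Complex.exp_add, wrightKernel_exp (by simpa using hu), Complex.ofReal_neg, hrpow,
    hrpow, neg_mul, hscaled, ← Complex.exp_add, ← Complex.exp_add, Complex.exp_add (L : ℂ) u,
    hphase]
  push_cast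
  ring_nf

section Bromwich

variable {lam a x : ℝ}

theorem mul_wrightKernel_vertical (u0 : ℝ) (hx : 0 < x) (τ : ℝ) :
    (((x / 2) ^ (a * x) * (x / 2 * Real.exp u0) : ℝ) : ℂ) *
      wrightKernel lam (a * x + 1) (-((x / 2) ^ (lam + 1)))
        ((x / 2 * Real.exp u0 : ℝ) + (x / 2 * Real.exp u0 * τ : ℝ) * I) =
      (Real.exp (x * phase lam a u0) : ℂ) * saddleIntegrand lam a u0 x τ := by
  have hne := Complex.slitPlane_ne_zero (one_add_mul_I_mem_slitPlane τ)
  set u : ℂ := u0 + Complex.log (1 + τ * I) with hu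
  have hpoint : ((x / 2 * Real.exp u0 : ℝ) : ℂ) * (1 + τ * I) = (x / 2 : ℝ) * Complex.exp u := by
    rw [hu, Complex.exp_add, Complex.exp_log hne]
    push_cast
    ring
  have hline : ((x / 2 * Real.exp u0 : ℝ) : ℂ) + (x / 2 * Real.exp u0 * τ : ℝ) * I =
      (x / 2 : ℝ) * Complex.exp u := by
    rw [← hpoint]
    push_cast
    ring
  have him : u.im ∈ Ioc (-π) π := by
    simpa [hu, Complex.log_im] using Complex.arg_mem_Ioc (1 + τ * I)
  have hkernel := mul_wrightKernel_half_mul_exp (lam := lam) (a := a) hx him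
  have hexp : Complex.exp (x * phaseC lam a u) = (Real.exp (x * phase lam a u0) : ℂ) *
      Complex.exp (x * (phaseC lam a u - phaseC lam a u0)) := by
    rw [phaseC_ofReal, Complex.ofReal_exp, ← Complex.exp_add]
    push_cast
    ring_nf
  rw [saddleIntegrand, ← hu, ← mul_div_assoc, ← hexp, eq_div_iff hne, ← hkernel, hline, ← hpoint]
  push_cast
  ring

theorem integrable_saddleIntegrand (u0 : ℝ) (hlam : -1 < lam) (hx : 0 < x) (hax : 0 < a * x) :
    Integrable (saddleIntegrand lam a u0 x) := by
  have hc : 0 < x / 2 * Real.exp u0 := by positivity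
  have hkernel := integrable_wrightKernel_vertical (mu := a * x + 1)
    (z := -((x / 2) ^ (lam + 1))) hlam (by linarith) (neg_nonpos.2 (by positivity)) hc
  refine (((hkernel.comp_mul_left' hc.ne').const_mul
    (((x / 2) ^ (a * x) * (x / 2 * Real.exp u0) : ℝ) : ℂ)).const_mul
      (Real.exp (x * phase lam a u0) : ℂ)⁻¹).congr (Eventually.of_forall fun τ => ?_)
  beta_reduce
  rw [mul_wrightKernel_vertical u0 hx, inv_mul_cancel_left₀]
  exact Complex.ofReal_ne_zero.2 (Real.exp_pos _).ne'

theorem wrightMinus_eq_integral (u0 : ℝ) (hlam : -1 < lam) (hx : 0 < x) (hax : 0 < a * x) :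
    (wrightMinus lam (a * x) x : ℂ) = (Real.exp (x * phase lam a u0) / (2 * π) : ℝ) *
      ∫ τ, saddleIntegrand lam a u0 x τ := by
  set c := x / 2 * Real.exp u0
  have hc : 0 < c := by positivity
  have hc_ne : (c : ℂ) ≠ 0 := Complex.ofReal_ne_zero.2 hc.ne'
  have hpi : (π : ℂ) ≠ 0 := Complex.ofReal_ne_zero.2 Real.pi_ne_zero
  set K : ℝ → ℂ := fun y => wrightKernel lam (a * x + 1) (-((x / 2) ^ (lam + 1))) (c + y * I)
  have hscale : (Real.exp (x * phase lam a u0) : ℂ) * ∫ τ, saddleIntegrand lam a u0 x τ =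
      (((x / 2) ^ (a * x) * c : ℝ) : ℂ) * ((c : ℂ)⁻¹ * ∫ y, K y) := by
    rw [← integral_const_mul]
    simp only [← mul_wrightKernel_vertical u0 hx]
    rw [integral_const_mul, Measure.integral_comp_mul_left K, abs_of_pos (inv_pos.2 hc),
      Complex.real_smul, Complex.ofReal_inv]
  have hbromwich := integral_wrightKernel_vertical (mu := a * x + 1)
    (z := -((x / 2) ^ (lam + 1))) hlam (by linarith) (neg_nonpos.2 (by positivity)) hc
  rw [Complex.ofReal_div, div_mul_eq_mul_div, hscale, hbromwich, wrightMinus]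
  push_cast
  field_simp

end Bromwich

section Expansion

variable {lam a u0 : ℝ}

theorem norm_saddleIntegrand_le {κ x x0 τ : ℝ} (hx : x0 ≤ x)
    (hre : (phaseC lam a (u0 + Complex.log (1 + τ * I)) - phaseC lam a u0).re ≤ -κ) :
    ‖saddleIntegrand lam a u0 x τ‖ ≤
      Real.exp (x0 * κ) * Real.exp (-κ * x) * ‖saddleIntegrand lam a u0 x0 τ‖ := by
  simp only [saddleIntegrand, norm_div, Complex.norm_exp, Complex.re_ofReal_mul]
  rw [← mul_div_assoc, ← Real.exp_add, ← Real.exp_add]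
  gcongr
  linarith [mul_le_mul_of_nonneg_left hre (sub_nonneg.2 hx)]

theorem isBigO_integral_saddleIntegrand_tail {δ : ℝ} (ha : 0 < a) (hlam : -1 < lam)
    (hu0 : u0 ∈ realSaddles lam a) (h2pos : 0 < phaseDeriv lam a u0 2) (hδ : 0 < δ) (N : ℕ) :
    (fun x : ℝ => (∫ τ, saddleIntegrand lam a u0 x τ) -
      ∫ τ in (-δ)..δ, saddleIntegrand lam a u0 x τ) =O[atTop] fun x => gaussianMoment x N := by
  obtain ⟨κ, hκ, hgap⟩ := exists_re_phaseC_sub_le_neg ha hlam hu0 h2pos hδ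
  have hint {x : ℝ} (hx : 1 ≤ x) : Integrable (saddleIntegrand lam a u0 x) :=
    integrable_saddleIntegrand u0 hlam (by linarith) (mul_pos ha (by linarith))
  refine IsBigO.trans (IsBigO.of_bound
    (Real.exp (1 * κ) * ∫ τ, ‖saddleIntegrand lam a u0 1 τ‖) ?_)
      (exp_neg_isBigO_gaussianMoment hκ N)
  filter_upwards [eventually_ge_atTop 1] with x hx
  rw [intervalIntegral.integral_of_le (by linarith), ← integral_add_compl (s := Ioc (-δ) δ)
    measurableSet_Ioc (hint hx), add_sub_cancel_left, Real.norm_of_nonneg (Real.exp_pos _).le]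
  have hmajorant := (hint le_rfl).norm.const_mul (Real.exp (1 * κ) * Real.exp (-κ * x))
  calc ‖∫ τ in (Ioc (-δ) δ)ᶜ, saddleIntegrand lam a u0 x τ‖
      ≤ ∫ τ in (Ioc (-δ) δ)ᶜ,
          Real.exp (1 * κ) * Real.exp (-κ * x) * ‖saddleIntegrand lam a u0 1 τ‖ := by
        refine norm_integral_le_of_norm_le hmajorant.integrableOn ?_
        filter_upwards [ae_restrict_mem measurableSet_Ioc.compl] with τ hτ
        refine norm_saddleIntegrand_le hx (hgap τ ?_)
        by_contra! hlt
        exact hτ ⟨(abs_lt.1 hlt).1, (abs_lt.1 hlt).2.le⟩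
    _ ≤ ∫ τ, Real.exp (1 * κ) * Real.exp (-κ * x) * ‖saddleIntegrand lam a u0 1 τ‖ :=
        setIntegral_le_integral hmajorant (Eventually.of_forall fun τ => by positivity)
    _ = Real.exp (1 * κ) * (∫ τ, ‖saddleIntegrand lam a u0 1 τ‖) * Real.exp (-κ * x) := by
        rw [integral_const_mul]
        ring

theorem saddlePrefactor_mul_eq_gaussianMoment {x : ℝ} (hx : 0 < x) (k : ℕ) :
    saddlePrefactor lam a u0 x * (poch (1 / 2) k / (x / 2) ^ k) =
      Real.exp (x * phase lam a u0) / (2 * π) *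
        (gaussianMoment x k / Real.sqrt (phaseDeriv lam a u0 2)) := by
  have hsqrt : Real.sqrt (2 * π / x) = 2 * π / Real.sqrt (2 * π * x) := by
    rw [show 2 * π / x = (2 * π) ^ 2 / (2 * π * x) by field_simp, Real.sqrt_div (by positivity),
      Real.sqrt_sq (by positivity)]
  rw [gaussianMoment_eq hx, saddlePrefactor, Real.sqrt_mul (by positivity), hsqrt]
  field_simp

theorem gaussianMoment_isBigO_saddlePrefactor (h2pos : 0 < phaseDeriv lam a u0 2) (N : ℕ) :
    (fun x => Real.exp (x * phase lam a u0) / (2 * π) * gaussianMoment x N) =O[atTop]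
      fun x => saddlePrefactor lam a u0 x / x ^ N := by
  have hsqrt : Real.sqrt (phaseDeriv lam a u0 2) ≠ 0 := (Real.sqrt_pos.2 h2pos).ne'
  refine (IsBigO.of_bound' ?_).trans ((isBigO_refl (fun x => saddlePrefactor lam a u0 x / x ^ N)
    atTop).const_mul_left (Real.sqrt (phaseDeriv lam a u0 2) * (poch (1 / 2) N * 2 ^ N)))
  filter_upwards [eventually_gt_atTop 0] with x hx
  refine le_of_eq (congrArg norm ?_)
  have hmoment := saddlePrefactor_mul_eq_gaussianMoment (lam := lam) (a := a) (u0 := u0) hx N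
  rw [← mul_div_assoc (Real.exp (x * phase lam a u0) / (2 * π)), eq_div_iff hsqrt] at hmoment
  rw [← hmoment, div_pow]
  field_simp

theorem IsSaddleReversion.isBigO_wrightMinus_sub {Ψ S : ℂ → ℂ}
    (hS : IsSaddleReversion lam a u0 Ψ S) (ha : 0 < a) (hlam : -1 < lam)
    (hu0 : u0 ∈ realSaddles lam a) (h2pos : 0 < phaseDeriv lam a u0 2) (N : ℕ) :
    (fun x : ℝ => wrightMinus lam (a * x) x - saddlePrefactor lam a u0 x *
        ∑ k ∈ Finset.range N, (-1) ^ k * poch (1 / 2) k * reversionCoeff lam a u0 S k / (x / 2) ^ k)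
      =O[atTop] fun x : ℝ => saddlePrefactor lam a u0 x / x ^ N := by
  obtain ⟨δ, hδ, hlocal⟩ := hS.exists_isBigO_integral_saddleIntegrand h2pos
  have hglobal := (Complex.isBigO_ofReal_left.2 (isBigO_refl
    (fun x : ℝ => Real.exp (x * phase lam a u0) / (2 * π)) atTop)).mul
      ((isBigO_integral_saddleIntegrand_tail ha hlam hu0 h2pos hδ N).add (hlocal N))
  refine (Complex.isBigO_ofReal_left.1 (hglobal.congr' ?_ EventuallyEq.rfl)).trans
    (gaussianMoment_isBigO_saddlePrefactor h2pos N)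
  filter_upwards [eventually_gt_atTop 0] with x hx
  rw [sub_add_sub_cancel, mul_sub, ← wrightMinus_eq_integral u0 hlam hx (mul_pos ha hx),
    ← Complex.ofReal_mul, ← Complex.ofReal_sub, Finset.sum_div, Finset.mul_sum, Finset.mul_sum]
  congr 2
  refine Finset.sum_congr rfl fun k _ => ?_
  linear_combination -((-1) ^ k * reversionCoeff lam a u0 S k) *
    saddlePrefactor_mul_eq_gaussianMoment (lam := lam) (a := a) (u0 := u0) hx k

end Expansion

end

theorem mainTheorem1 (lam a : ℝ) (ha : 0 < a)
    (hlam : (-1 < lam ∧ lam < 0) ∨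
      (0 < lam ∧ (1 / 2 : ℝ) * (1 + lam) * lam ^ ((1 - lam) / (1 + lam)) < a)) :
    -- the series defining the Wright function converges
    (∀ mu z : ℝ, Summable fun n : ℕ =>
      z ^ n / ((n.factorial : ℝ) * Real.Gamma (lam * n + mu))) ∧
    -- `u0` is the only real saddle for `lam < 0` and the larger of exactly two for `lam > 0`
    ∃ u0 : ℝ, IsGreatest (realSaddles lam a) u0 ∧
      (lam < 0 → realSaddles lam a = {u0}) ∧
      (0 < lam → (realSaddles lam a).ncard = 2) ∧
      0 < phaseDeriv lam a u0 2 ∧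
      (∀ n : ℕ, 2 ≤ n → phaseDeriv lam a u0 n =
        (1 - (-lam) ^ (n - 1)) * Real.exp u0 / 2 + a * (-lam) ^ (n - 1)) ∧
      ∃ A : ℕ → ℝ, IsReversionCoeffs lam a u0 A ∧
        A 0 = 1 ∧
        (∀ h2 h3 h4 h5 h6 h7 h8 : ℝ,
          h2 = phaseDeriv lam a u0 2 →
          h3 = phaseRatio lam a u0 3 → h4 = phaseRatio lam a u0 4 →
          h5 = phaseRatio lam a u0 5 → h6 = phaseRatio lam a u0 6 →
          h7 = phaseRatio lam a u0 7 → h8 = phaseRatio lam a u0 8 →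
          A 1 = (5 * h3 ^ 2 - 3 * h4) / (24 * h2) ∧
          A 2 = (385 * h3 ^ 4 - 630 * h3 ^ 2 * h4 + 105 * h4 ^ 2 + 168 * h3 * h5 - 24 * h6)
            / (3456 * h2 ^ 2) ∧
          A 3 = (425425 * h3 ^ 6 - 1126125 * h3 ^ 4 * h4 + 675675 * h3 ^ 2 * h4 ^ 2
              - 51975 * h4 ^ 3 + 360360 * h3 ^ 3 * h5 - 249480 * h3 * h4 * h5
              + 13608 * h5 ^ 2 - 83160 * h3 ^ 2 * h6 + 22680 * h4 * h6
              + 12960 * h3 * h7 - 1080 * h8) / (6220800 * h2 ^ 3)) ∧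
        -- the asymptotic expansion to every order `N`
        ∀ N : ℕ,
          (fun x : ℝ => wrightMinus lam (a * x) x - saddlePrefactor lam a u0 x *
              ∑ k ∈ Finset.range N, (-1) ^ k * poch (1 / 2) k * A k / (x / 2) ^ k)
            =O[atTop] fun x : ℝ => saddlePrefactor lam a u0 x / x ^ N := by
  have hlam1 : -1 < lam := by rcases hlam with h | h <;> linarith [h.1]
  obtain ⟨u0, hgreatest, hneg, hcard, h2pos⟩ := exists_isGreatest_realSaddles ha hlam
  obtain ⟨Ψ, S, hS⟩ := exists_isSaddleReversion hgreatest.1 h2pos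
  refine ⟨summable_wright hlam1, u0, hgreatest, hneg, hcard, h2pos,
    fun n hn => phaseDeriv_eq hgreatest.1 hn, reversionCoeff lam a u0 S,
    hS.isReversionCoeffs h2pos, hS.reversionCoeff_zero, ?_,
    hS.isBigO_wrightMinus_sub ha hlam1 hgreatest.1 h2pos⟩
  rintro h2 h3 h4 h5 h6 h7 h8 rfl rfl rfl rfl rfl rfl rfl
  exact hS.reversionCoeff_eq hgreatest.1 rfl h2pos fun _ => rfl
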